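/- **Setting.** Let $D>0$, $H\ge 0$, $\delta>0$ and $C\ge 20HD^2+2D\sqrt{2\delta}$. Let $\mathcal W\subseteq\mathbb R^d$ be nonempty, closed and convex with $\|w-w'\|\le D$ for all $w,w'\in\mathcal W$. Let $f_1,\dots,f_T:\mathbb R^d\to[0,\infty)$ be differentiable on $\mathbb R^d$ and convex on $\mathcal W$, with $f_t\le 1$ on $\mathcal W$ and $\|\nabla f_t(w)-\nabla f_t(w')\|\le H\|w-w'\|$ for all $w\in\mathcal W$, $w'\in\mathbb R^d$. **SOGD.** An instance of scale-free online gradient descent starts at an arbitrary point of $\mathcal W$ and, on receiving $f$ at its current point $x$, moves to $\Pi_{\mathcal W}[x-\eta\nabla f(x)]$, where $\eta=\frac{D/\sqrt2}{\sqrt{\delta+G}}$ and $G$ is the sum of the squared norms of all gradients that this instance has met at its own iterates, the current one included. **SACS with compact problem-dependent geometric covering intervals.** An SOGD instance (expert) is created in round $1$ and, after that, in each round that follows a round in which the cumulative loss of the most recently created expert (since its creation) exceeds $C$. The round $s_m$ in which the $m$-th expert $E_{s_m}$ is created is the $m$-th marker. If $m=i2^k$ with $i$ odd, $E_{s_m}$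 is active in the rounds $s_{i2^k},\dots,s_{(i+1)2^k}-1$. Let $w_{t,i}$ be the point of the expert $E_i$ in round $t$. With $\Phi(R,A)=\exp\left(\frac{\max(0,R)^2}{3A}\right)$, $\Phi(0,0)=1$ and $\omega(R,A)=\frac12\left(\Phi(R+1,A+1)-\Phi(R-1,A+1)\right)$, the decision in round $t$ is the average $w_t=\sum_i p_{t,i}w_{t,i}$ over the active experts with weights $p_{t,i}\propto\omega(R_{t-1,i},A_{t-1,i})$, where $R_{t-1,i}=\sum_{u=i}^{t-1}(f_u(w_u)-f_u(w_{u,i}))$ and $A_{t-1,i}=\sum_{u=i}^{t-1}|f_u(w_u)-f_u(w_{u,i})|$; if all these weights vanish, $w_t\in\mathcal W$ is arbitrary. Then $f_t$ is revealed and passed to all experts that remain active. **Theorem.** Write $L_r^s(w)=\sum_{t=r}^s f_t(w)$ and $\lambda(t)=\ln\frac{5+3\ln(1+t)}2$. There is a quantity $\tilde c(t)\ge 0$, $1\le t\le T$ (independent of $w$ and of the interval), such that $$\tilde c(t)\le 3\ln\Big(1+\frac4C L_1^t(w)\Big)+3\lambda(t)\qquad\text{for all } w\in\mathcal W,$$ and,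 with $\tilde a(t)=\frac32\tilde c(t)+18HD^2+2D\sqrt{2\delta}$ and $\tilde b(t)=8\tilde c(t)+16HD^2$, the following holds. For all $1\le r\le s\le T$ and all $w\in\mathcal W$ there is an integer $0\le v\le\left\lceil\log_2\left(2+\frac4C L_r^s(w)\right)\right\rceil$ with $$\sum_{t=r}^s\big[f_t(w_t)-f_t(w)\big]\le B:=2(C+1)+\frac32\tilde c(s)+v\,\tilde a(s)+\sqrt{v\,\tilde b(s)\,L_r^s(w)} .$$ Moreover, there is a constant $K>0$ that depends only on $H,D,\delta,C$ such that, if $L_r^s(w)\ge 2$, then, with $M=\lambda(s)\,\ln L_1^s(w)\,\ln L_r^s(w)$, $$B\le K\big(\sqrt{L_r^s(w)\,M}+M\big),\qquad\text{and } B\le K\sqrt{L_r^s(w)\,M}\ \text{ whenever } M\le L_r^s(w).$$ Thus, with the double logarithm $\lambda(s)$ treated as a constant and up to the lower-order term $M$, the regret is $O\left(\sqrt{L_r^s(w)\cdot\log L_1^s(w)\cdot\log L_r^s(w)}\right)$. -/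

import Mathlib

noncomputable section

namespace SACS

/-- The Euclidean space `ℝᵈ`. -/
abbrev E (d : ℕ) : Type := EuclideanSpace ℝ (Fin d)

/-- A nearest point of `W` to `x`. For a nonempty closed convex `W` it exists and is unique. -/
def proj {d : ℕ} (W : Set (E d)) (x : E d) : E d :=
  Classical.epsilon fun p => p ∈ W ∧ ∀ q ∈ W, ‖x - p‖ ≤ ‖x - q‖

/-- The inputs of the procedure. -/
structure Input (d : ℕ) where
  /-- the decision set -/
  W : Set (E d)
  /-- the parameter `α` of scale-free online gradient descent -/
  α : ℝ
  /-- the parameter `δ` of scale-free online gradient descent -/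
  δ : ℝ
  /-- the threshold on the cumulative loss that triggers a restart -/
  C : ℝ
  /-- the (arbitrary) first decision of the expert that is created in round `t` -/
  init : ℕ → E d
  /-- the (arbitrary) decision of round `t` if the weights of all active experts vanish,
  so that they cannot be normalized -/
  fallback : ℕ → E d

/-! ### Scale-free online gradient descent (SOGD) -/

/-- The state of an instance of SOGD. -/
structure SOGD (d : ℕ) where
  /-- the current decision -/
  w : E d
  /-- the sum of the squared norms of the gradients received so far -/
  G : ℝ

/-- A new instance of SOGD. -/
def SOGD.new {d : ℕ} (x : E d) : SOGD d := ⟨x, 0⟩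

/-- One update of SOGD: after receiving `f`, a projected gradient step of size
`α / √(δ + ∑ ‖gradient‖ ^ 2)`, where the sum includes the current gradient. -/
def SOGD.step {d : ℕ} (W : Set (E d)) (α δ : ℝ) (f : E d → ℝ) (e : SOGD d) : SOGD d where
  w := proj W (e.w - (α / √(δ + (e.G + ‖gradient f e.w‖ ^ 2))) • gradient f e.w)
  G := e.G + ‖gradient f e.w‖ ^ 2

/-! ### AdaNormalHedge -/

/-- The potential `exp ([R]₊² / (3 C))`, with value `1` at `(0, 0)` since `0 / 0 = 0`. -/
def potential (R C : ℝ) : ℝ := Real.exp ((max 0 R) ^ 2 / (3 * C))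

/-- The weight function of the potential. -/
def weight (R C : ℝ) : ℝ := (1 / 2) * (potential (R + 1) (C + 1) - potential (R - 1) (C + 1))

/-! ### Compact geometric covering intervals -/

/-- `[a, b]` is a compact geometric covering interval:
`[i * 2 ^ k, (i + 1) * 2 ^ k - 1]` with `i` odd. -/
def IsCGC (a b : ℕ) : Prop :=
  ∃ i k : ℕ, Odd i ∧ a = i * 2 ^ k ∧ b = (i + 1) * 2 ^ k - 1

/-- The index `j` such that `[m, j - 1]` is a compact geometric covering interval. -/
def endIndex (m : ℕ) : ℕ := m + 2 ^ padicValNat 2 m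

theorem isCGC_iff {m j : ℕ} (hm : 0 < m) (hj : 0 < j) :
    IsCGC m (j - 1) ↔ j = endIndex m := by
  unfold IsCGC endIndex
  constructor
  · rintro ⟨i, k, hi, rfl, hb⟩
    have h1 : padicValNat 2 (i * 2 ^ k) = k := by
      have hi0 : i ≠ 0 := by rintro rfl; simp at hi
      rw [padicValNat.mul hi0 (by positivity), padicValNat.prime_pow,
        padicValNat.eq_zero_of_not_dvd hi.not_two_dvd_nat, zero_add]
    have h2 : 0 < (i + 1) * 2 ^ k := by positivity
    rw [h1]
    have h3 : (i + 1) * 2 ^ k = i * 2 ^ k + 2 ^ k := by ring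
    omega
  · rintro rfl
    obtain ⟨k, i, hi, h⟩ := Nat.exists_eq_two_pow_mul_odd hm.ne'
    refine ⟨i, k, hi, by rw [h]; ring, ?_⟩
    have h1 : padicValNat 2 m = k := by
      have hi0 : i ≠ 0 := by rintro rfl; simp at hi
      rw [h, padicValNat.mul (by positivity) hi0, padicValNat.prime_pow,
        padicValNat.eq_zero_of_not_dvd hi.not_two_dvd_nat, add_zero]
    rw [h1]
    congr 1
    rw [h]; ring

/-! ### The algorithm -/

/-- An expert, with the quantities that the algorithm maintains for it. -/
structure Expert (d : ℕ) where
  /-- the instance of SOGD that the expert runs -/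
  alg : SOGD d
  /-- the sum of the instantaneous regrets with respect to this expert -/
  R : ℝ
  /-- the sum of the absolute values of the instantaneous regrets -/
  A : ℝ
  /-- the number of the marker at which the expert is removed -/
  g : ℕ

/-- The state of the algorithm between two rounds. -/
structure State (d : ℕ) where
  /-- whether a new interval has to be created -/
  newInterval : Bool
  /-- the number of intervals created so far -/
  m : ℕ
  /-- the index of the latest expert -/
  n : ℕ
  /-- the indices (creation rounds) of the active experts -/
  active : Finset ℕ
  /-- the experts, indexed by the round of their creation -/
  expert : ℕ → Expert d
  /-- the cumulative loss of the latest expert -/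
  L : ℝ

/-- The state before the first round. -/
def State.start (d : ℕ) : State d where
  newInterval := true
  m := 0
  n := 0
  active := ∅
  expert := fun _ => ⟨⟨0, 0⟩, 0, 0, 0⟩
  L := 0

/-- First part of round `t`: if required, create a new expert. -/
def State.create {d : ℕ} (P : Input d) (t : ℕ) (S : State d) : State d :=
  if S.newInterval = true then
    { newInterval := false
      m := S.m + 1
      n := t
      active := insert t S.active
      expert := Function.update S.expert t ⟨SOGD.new (P.init t), 0, 0, endIndex (S.m + 1)⟩
      L := 0 }
  else S

/-- Second part of round `t`: the decision, which is the weighted average of the decisions of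
the active experts. -/
def State.decide {d : ℕ} (P : Input d) (t : ℕ) (S : State d) : E d :=
  let p : ℕ → ℝ := fun i => weight (S.expert i).R (S.expert i).A
  if ∑ i ∈ S.active, p i = 0 then P.fallback t
  else ∑ i ∈ S.active, (p i / ∑ j ∈ S.active, p j) • (S.expert i).alg.w

/-- Update of an expert after the decision `x` was made and the loss function `f` was received. -/
def Expert.update {d : ℕ} (P : Input d) (f : E d → ℝ) (x : E d) (e : Expert d) : Expert d where
  alg := e.alg.step P.W P.α P.δ f
  R := e.R + (f x - f e.alg.w)
  A := e.A + |f x - f e.alg.w|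
  g := e.g

/-- Third part of a round: after the decision `x` was made and the loss function `f` was
received, update the cumulative loss of the latest expert; if it exceeds the threshold, request
a new interval and remove the experts that end at the next marker; update the remaining active
experts. -/
def State.finish {d : ℕ} (P : Input d) (f : E d → ℝ) (x : E d) (S : State d) : State d :=
  let L' : ℝ := S.L + f (S.expert S.n).alg.w
  let act : Finset ℕ :=
    if P.C < L' then S.active.filter (fun i => (S.expert i).g ≠ S.m + 1) else S.active
  { newInterval := if P.C < L' then true else S.newInterval
    m := S.m
    n := S.n
    active := act
    expert := fun i => if i ∈ act then (S.expert i).update P f x else S.expert i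
    L := L' }

/-- The state after the first `t` rounds, on the loss functions `f 1, f 2, …`. -/
def stateAfter {d : ℕ} (P : Input d) (f : ℕ → E d → ℝ) : ℕ → State d
  | 0 => State.start d
  | t + 1 =>
    let S := (stateAfter P f t).create P (t + 1)
    S.finish P (f (t + 1)) (S.decide P (t + 1))

/-- The decision of the algorithm in round `t ≥ 1`. -/
def decision {d : ℕ} (P : Input d) (f : ℕ → E d → ℝ) (t : ℕ) : E d :=
  ((stateAfter P f (t - 1)).create P t).decide P t

/-! ### Assumptions and the quantities in the bound -/

/-- `f` is differentiable and `H`-smooth at the points of `W`: the gradients at a point of `W`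
and at any point of the space differ by at most `H` times the distance. -/
def SmoothAround {d : ℕ} (H : ℝ) (W : Set (E d)) (f : E d → ℝ) : Prop :=
  Differentiable ℝ f ∧
    ∀ x ∈ W, ∀ y : E d, ‖gradient f x - gradient f y‖ ≤ H * ‖x - y‖

/-- The cumulative loss `∑_{t = r}^{s} f_t(w)`. -/
def cumLoss {d : ℕ} (f : ℕ → E d → ℝ) (r s : ℕ) (w : E d) : ℝ := ∑ t ∈ Finset.Icc r s, f t w

/-- The doubly logarithmic term `ln ((5 + 3 ln (1 + t)) / 2)`. -/
def logLog (t : ℕ) : ℝ := Real.log ((5 + 3 * Real.log (1 + t)) / 2)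

/-- The bound `ã` as a function of `c̃`. -/
def aTilde (H D δ c : ℝ) : ℝ := (3 / 2) * c + 18 * H * D ^ 2 + 2 * D * √(2 * δ)

/-- The bound `b̃` as a function of `c̃`. -/
def bTilde (H D c : ℝ) : ℝ := 8 * c + 16 * H * D ^ 2

/-- The regret bound for an interval that is covered by `v` intervals of the algorithm, with
`c = c̃(s)` and `L` the cumulative loss of the comparator. -/
def regretBound (H D δ C : ℝ) (v : ℕ) (c L : ℝ) : ℝ :=
  2 * (C + 1) + (3 / 2) * c + v * aTilde H D δ c + √(v * bTilde H D c * L)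

end SACS

end

namespace SACS

/-! ### Elementary inequalities -/

theorem le_add_sqrt_of_sq_le {z a m : ℝ} (ha : 0 ≤ a) (h : z ^ 2 ≤ a * z + m) :
    z ≤ a + √m := by
  by_contra! hz
  have hs := Real.sqrt_nonneg m
  have h1 : m ≤ √m * √m := by
    rcases le_total 0 m with hm | hm
    · rw [Real.mul_self_sqrt hm]
    · exact hm.trans (mul_self_nonneg _)
  nlinarith

theorem sqrt_mul_le_half_add {x y : ℝ} (hx : 0 ≤ x) (hy : 0 ≤ y) : √(x * y) ≤ (x + y) / 2 := by
  rw [Real.sqrt_le_left (by positivity)]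
  nlinarith [sq_nonneg (x - y)]

theorem sqrt_add_le_sqrt_add_sqrt {x y : ℝ} (hx : 0 ≤ x) (hy : 0 ≤ y) : √(x + y) ≤ √x + √y := by
  rw [Real.sqrt_le_left (by positivity)]
  nlinarith [Real.sq_sqrt hx, Real.sq_sqrt hy, mul_nonneg (Real.sqrt_nonneg x) (Real.sqrt_nonneg y)]

theorem sqrt_add_sqrt_le (x y : ℝ) (hx : 0 ≤ x) (hy : 0 ≤ y) : √x + √y ≤ √(2 * (x + y)) := by
  apply Real.le_sqrt_of_sq_le
  nlinarith [sq_nonneg (√x - √y), Real.sq_sqrt hx, Real.sq_sqrt hy]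

/-- Cauchy–Schwarz in the form that adds one interval to a chain of n intervals whose square roots
are already merged. -/
theorem sqrt_add_sqrt_mul_le {n x y : ℝ} (hn : 0 ≤ n) (hx : 0 ≤ x) (hy : 0 ≤ y) :
    √x + √(n * y) ≤ √((n + 1) * (x + y)) := by
  apply Real.le_sqrt_of_sq_le
  rw [Real.sqrt_mul hn]
  have h1 := Real.sq_sqrt hn
  have h2 := Real.sq_sqrt hx
  have h3 := Real.sq_sqrt hy
  nlinarith [sq_nonneg (√n * √x - √y)]

/-! ### The potential of AdaNormalHedge -/

theorem potential_pos (R A : ℝ) : 0 < potential R A := Real.exp_pos _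

theorem potential_mono {R R' A : ℝ} (hA : 0 ≤ A) (h : R ≤ R') : potential R A ≤ potential R' A := by
  unfold potential
  gcongr

theorem weight_nonneg {R A : ℝ} (hA : 0 ≤ A) : 0 ≤ weight R A := by
  have := potential_mono (A := A + 1) (by positivity) (show R - 1 ≤ R + 1 by linarith)
  unfold weight
  linarith

theorem potential_of_nonpos {R A : ℝ} (hR : R ≤ 0) : potential R A = 1 := by
  simp [potential, max_eq_left hR]

/-- The core of AdaNormalHedge: a fair ±1 step of R raises the potential by only O(1/(A + 1)),
because the simultaneous growth of A offsets the variance of the step. -/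
theorem potential_average_le_of_nonneg {R A : ℝ} (hR : 0 ≤ R) (hRA : R ≤ A) :
    (potential (R + 1) (A + 1) + potential (R - 1) (A + 1)) / 2
      ≤ potential R A + 3 / 2 / (A + 1) := by
  have hA : 0 ≤ A := hR.trans hRA
  set x := R ^ 2 / (3 * A) with hx
  have hx0 : 0 ≤ x := by positivity
  have hpot : potential R A = Real.exp x := by rw [potential, max_eq_right hR]
  have h1 : potential (R + 1) (A + 1) = Real.exp ((R + 1) ^ 2 / (3 * (A + 1))) := by
    rw [potential, max_eq_right (by linarith)]
  have h2 : potential (R - 1) (A + 1) ≤ Real.exp ((R - 1) ^ 2 / (3 * (A + 1))) := by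
    unfold potential
    have hs : max 0 (R - 1) ^ 2 ≤ (R - 1) ^ 2 := by
      rcases le_total 0 (R - 1) with h | h
      · rw [max_eq_right h]
      · rw [max_eq_left h]; rw [zero_pow two_ne_zero]; positivity
    gcongr Real.exp (?_ / _)
  -- The cross terms ±2R form a hyperbolic cosine, which is at most the exponential of half the
  -- squared argument.
  have h3 : (Real.exp ((R + 1) ^ 2 / (3 * (A + 1))) + Real.exp ((R - 1) ^ 2 / (3 * (A + 1)))) / 2
      = Real.exp ((R ^ 2 + 1) / (3 * (A + 1))) * Real.cosh (2 * R / (3 * (A + 1))) := by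
    rw [Real.cosh_eq, mul_div_assoc', mul_add (Real.exp _), ← Real.exp_add, ← Real.exp_add]
    congr 4 <;> ring
  have h4 : (R ^ 2 + 1) / (3 * (A + 1)) + (2 * R / (3 * (A + 1))) ^ 2 / 2
      ≤ x + (1 - x) / (3 * (A + 1)) := by
    rcases hA.eq_or_lt with rfl | hA'
    · have : R = 0 := le_antisymm hRA hR
      subst this
      simp [hx]
    · have : x + (1 - x) / (3 * (A + 1))
          - ((R ^ 2 + 1) / (3 * (A + 1)) + (2 * R / (3 * (A + 1))) ^ 2 / 2)
          = R ^ 2 * 2 / (9 * A * (A + 1) ^ 2) := by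
        rw [hx]; field_simp; ring
      have : 0 ≤ R ^ 2 * 2 / (9 * A * (A + 1) ^ 2) := by positivity
      linarith
  -- The exponent increases only if x ≤ 1. Then the increase y is at most 1/3, so e^y - 1 ≤ 3y/2,
  -- while e^x (1 - x) ≤ 1 bounds e^x y by 1/(3(A + 1)).
  have h5 : Real.exp (x + (1 - x) / (3 * (A + 1))) ≤ Real.exp x + 3 / 2 / (A + 1) := by
    rcases le_total 1 x with h | h
    · have : (1 - x) / (3 * (A + 1)) ≤ 0 := div_nonpos_of_nonpos_of_nonneg (by linarith) (by linarith)
      have h6 : Real.exp (x + (1 - x) / (3 * (A + 1))) ≤ Real.exp x := by gcongr; linarith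
      have : 0 ≤ 3 / 2 / (A + 1) := by positivity
      linarith
    · set y := (1 - x) / (3 * (A + 1)) with hy
      have hy0 : 0 ≤ y := div_nonneg (by linarith) (by linarith)
      have hy1 : y ≤ 1 / 3 := by
        rw [hy, div_le_iff₀ (by linarith)]; linarith
      have h6 : Real.exp x * (1 - x) ≤ 1 := by
        have := Real.add_one_le_exp (-x)
        calc Real.exp x * (1 - x) ≤ Real.exp x * Real.exp (-x) := by gcongr; linarith
          _ = 1 := by rw [← Real.exp_add]; simp
      have h7 : Real.exp y * (1 - y) ≤ 1 := by
        have := Real.add_one_le_exp (-y)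
        calc Real.exp y * (1 - y) ≤ Real.exp y * Real.exp (-y) := by gcongr; linarith
          _ = 1 := by rw [← Real.exp_add]; simp
      have h8 : Real.exp y ≤ 3 / 2 := by nlinarith [Real.exp_pos y]
      have h9 : Real.exp y - 1 ≤ 3 / 2 * y := by nlinarith
      rw [Real.exp_add]
      have h10 : Real.exp x * y ≤ 1 / (3 * (A + 1)) := by
        rw [hy, mul_div_assoc']
        gcongr
      have h11 : 3 / 2 / (A + 1) = 9 / 2 * (1 / (3 * (A + 1))) := by field_simp; norm_num
      have h12 : 0 < 1 / (3 * (A + 1)) := by positivity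
      nlinarith [Real.exp_pos x]
  have h13 : Real.exp ((R ^ 2 + 1) / (3 * (A + 1))) * Real.cosh (2 * R / (3 * (A + 1)))
      ≤ Real.exp x + 3 / 2 / (A + 1) := by
    refine le_trans ?_ h5
    refine le_trans ?_ (Real.exp_le_exp.2 h4)
    rw [Real.exp_add]
    gcongr
    exact Real.cosh_le_exp_half_sq _
  rw [hpot, h1]
  linarith

theorem potential_average_le {R A : ℝ} (hA : 0 ≤ A) (hRA : R ≤ A) :
    (potential (R + 1) (A + 1) + potential (R - 1) (A + 1)) / 2
      ≤ potential R A + 3 / 2 / (A + 1) := by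
  rcases le_total 0 R with hR | hR
  · exact potential_average_le_of_nonneg hR hRA
  · have h0 := potential_average_le_of_nonneg le_rfl hA
    rw [potential_of_nonpos le_rfl] at h0
    rw [potential_of_nonpos hR]
    have h1 := potential_mono (A := A + 1) (by linarith) (show R + 1 ≤ 0 + 1 by linarith)
    have h2 := potential_mono (A := A + 1) (by linarith) (show R - 1 ≤ 0 - 1 by linarith)
    exact (div_le_div_of_nonneg_right (add_le_add h1 h2) zero_le_two).trans h0

/-- Joint convexity of the perspective function a²/A along a segment. At A = 0 the quotient is 0 by
convention, which is harmless only for a = 0. -/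
theorem convex_sq_div {a b A θ : ℝ} (hA : 0 ≤ A) (haA : A = 0 → a = 0)
    (hθ : 0 ≤ θ) (hθ1 : θ ≤ 1) :
    ((1 - θ) * a + θ * b) ^ 2 / (3 * (A + θ))
      ≤ (1 - θ) * (a ^ 2 / (3 * A)) + θ * (b ^ 2 / (3 * (A + 1))) := by
  rcases hA.eq_or_lt with rfl | hA
  · rw [haA rfl]
    rcases hθ.eq_or_lt with rfl | hθ
    · simp
    · have : ((1 - θ) * 0 + θ * b) ^ 2 / (3 * (0 + θ)) = θ * (b ^ 2 / (3 * (0 + 1))) := by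
        field_simp; ring
      rw [this]; simp
  · have : (1 - θ) * (a ^ 2 / (3 * A)) + θ * (b ^ 2 / (3 * (A + 1)))
        - ((1 - θ) * a + θ * b) ^ 2 / (3 * (A + θ))
        = (1 - θ) * θ * (a * (A + 1) - b * A) ^ 2 / (3 * A * (A + 1) * (A + θ)) := by
      field_simp
      ring
    have h2 : 0 ≤ 1 - θ := by linarith
    have : 0 ≤ (1 - θ) * θ * (a * (A + 1) - b * A) ^ 2 / (3 * A * (A + 1) * (A + θ)) := by
      positivity
    linarith

theorem potential_convex {R A θ σ : ℝ} (hA : 0 ≤ A) (hRA : R ≤ A) (hθ : 0 ≤ θ) (hθ1 : θ ≤ 1) :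
    potential (R + θ * σ) (A + θ)
      ≤ (1 - θ) * potential R A + θ * potential (R + σ) (A + 1) := by
  have hmax : max 0 (R + θ * σ) ≤ (1 - θ) * max 0 R + θ * max 0 (R + σ) := by
    have h1 := le_max_left 0 R
    have h2 := le_max_left 0 (R + σ)
    have h3 := le_max_right 0 R
    have h4 := le_max_right 0 (R + σ)
    have h5 : 0 ≤ 1 - θ := by linarith
    refine max_le (by positivity) ?_
    have := mul_le_mul_of_nonneg_left h3 h5
    have := mul_le_mul_of_nonneg_left h4 hθ
    linarith
  have h1 : max 0 (R + θ * σ) ^ 2 / (3 * (A + θ)) ≤ (1 - θ) * (max 0 R ^ 2 / (3 * A))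
      + θ * (max 0 (R + σ) ^ 2 / (3 * (A + 1))) := by
    refine le_trans ?_ (convex_sq_div hA
      (fun h => max_eq_left (by linarith)) hθ hθ1)
    gcongr
  have h2 := convexOn_exp.2 (Set.mem_univ (max 0 R ^ 2 / (3 * A)))
    (Set.mem_univ (max 0 (R + σ) ^ 2 / (3 * (A + 1))))
    (show 0 ≤ 1 - θ by linarith) hθ (by ring)
  simp only [smul_eq_mul] at h2
  exact (Real.exp_le_exp.2 h1).trans h2

/-- The point (R + r, A + |r|) lies on the segment from (R, A) to (R ± 1, A + 1). By convexity it
suffices to know the endpoint, where the potential is the average of the two endpoint values plus or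
minus `weight R A`. -/
theorem potential_add_le {R A r : ℝ} (hRA : |R| ≤ A) (hr : |r| ≤ 1) :
    potential (R + r) (A + |r|)
      ≤ potential R A + weight R A * r + 3 / 2 * (|r| / (A + 1)) := by
  have hA : 0 ≤ A := (abs_nonneg R).trans hRA
  have hR : R ≤ A := (le_abs_self R).trans hRA
  have havg := potential_average_le hA hR
  have e : 3 / 2 * (|r| / (A + 1)) = |r| * (3 / 2 / (A + 1)) := by ring
  rw [e]
  rcases le_total 0 r with h | h
  · rw [abs_of_nonneg h] at hr ⊢
    have := potential_convex (σ := 1) hA hR h hr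
    rw [mul_one] at this
    refine this.trans ?_
    have := mul_le_mul_of_nonneg_left havg h
    unfold weight
    linarith
  · rw [abs_of_nonpos h] at hr ⊢
    have := potential_convex (σ := -1) hA hR (by linarith : 0 ≤ -r) hr
    rw [show R + -r * -1 = R + r by ring, show R + -1 = R - 1 by ring] at this
    refine this.trans ?_
    have := mul_le_mul_of_nonneg_left havg (by linarith : 0 ≤ -r)
    unfold weight
    linarith

/-- Makes the error terms telescope. The denominator involves A before the update, so the logarithm
alone is too small; the term -1/(1 + A) makes up for the lag. -/
theorem div_add_one_le {A a : ℝ} (hA : 0 ≤ A) (ha : 0 ≤ a) (ha1 : a ≤ 1) :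
    a / (A + 1) ≤ (Real.log (1 + (A + a)) - 1 / (1 + (A + a)))
      - (Real.log (1 + A) - 1 / (1 + A)) := by
  have h1 : a / (1 + (A + a)) ≤ Real.log (1 + (A + a)) - Real.log (1 + A) := by
    have := Real.one_sub_inv_le_log_of_pos (show 0 < (1 + (A + a)) / (1 + A) by positivity)
    rw [Real.log_div (by positivity) (by positivity)] at this
    convert this using 1
    field_simp
    ring
  have h2 : 1 / (1 + A) - 1 / (1 + (A + a)) - (a / (A + 1) - a / (1 + (A + a)))
      = a * (1 - a) / ((1 + A) * (1 + (A + a))) := by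
    field_simp
    ring
  have h3 : 0 ≤ a * (1 - a) / ((1 + A) * (1 + (A + a))) := by
    have : 0 ≤ 1 - a := by linarith
    positivity
  linarith

/-- The regret bound of AdaNormalHedge with sleeping experts, in terms of the potential. -/
theorem potential_le_of_hedge {act : ℕ → Finset ℕ} {I : Finset ℕ} {r : ℕ → ℕ → ℝ} {s : ℕ}
    (hact : ∀ t ∈ Finset.Icc 1 s, act t ⊆ I) (hr : ∀ t ∈ Finset.Icc 1 s, ∀ i ∈ act t, |r t i| ≤ 1)
    {R A : ℕ → ℕ → ℝ}
    (hR : ∀ t i, R t i = ∑ u ∈ Finset.Icc 1 t, if i ∈ act u then r u i else 0)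
    (hA : ∀ t i, A t i = ∑ u ∈ Finset.Icc 1 t, if i ∈ act u then |r u i| else 0)
    (hw : ∀ t ∈ Finset.Icc 1 s,
      ∑ i ∈ act t, weight (R (t - 1) i) (A (t - 1) i) * r t i ≤ 0)
    {i : ℕ} (hi : i ∈ I) :
    potential (R s i) (A s i) ≤ (I.card : ℝ) * ((5 + 3 * Real.log (1 + s)) / 2) := by
  have hRS : ∀ t i, R (t + 1) i = R t i + if i ∈ act (t + 1) then r (t + 1) i else 0 := by
    intro t i
    rw [hR, hR, Finset.sum_Icc_succ_top (by omega)]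
  have hAS : ∀ t i, A (t + 1) i = A t i + if i ∈ act (t + 1) then |r (t + 1) i| else 0 := by
    intro t i
    rw [hA, hA, Finset.sum_Icc_succ_top (by omega)]
  have hA0 : ∀ t i, 0 ≤ A t i := by
    intro t i
    rw [hA]
    exact Finset.sum_nonneg fun u _ => by split_ifs <;> positivity
  have hRA : ∀ t i, |R t i| ≤ A t i := by
    intro t i
    rw [hA, hR]
    refine (Finset.abs_sum_le_sum_abs _ _).trans (Finset.sum_le_sum fun u _ => ?_)
    split_ifs <;> simp
  have hAs : ∀ i, A s i ≤ s := by
    intro i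
    rw [hA]
    calc _ ≤ ∑ u ∈ Finset.Icc 1 s, (1 : ℝ) := Finset.sum_le_sum fun u hu => by
          split_ifs with h
          · exact hr u hu i h
          · norm_num
      _ = s := by simp
  -- The compensated total potential never increases: the linear terms sum to at most 0 by `hw`, the
  -- errors telescope, and sleeping experts do not change. The summand + 1 cancels the value -1 of
  -- the compensator at A = 0.
  have key : ∀ t ≤ s, ∑ i ∈ I, (potential (R t i) (A t i)
      - 3 / 2 * (Real.log (1 + A t i) - 1 / (1 + A t i) + 1)) ≤ I.card := by
    intro t
    induction t with
    | zero =>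
      intro _
      simp [hR, hA, potential]
    | succ t ih =>
      intro ht
      have hmem : t + 1 ∈ Finset.Icc 1 s := by simp; omega
      have h1 : ∀ i ∈ I, (potential (R (t + 1) i) (A (t + 1) i)
          - 3 / 2 * (Real.log (1 + A (t + 1) i) - 1 / (1 + A (t + 1) i) + 1))
          ≤ (potential (R t i) (A t i) - 3 / 2 * (Real.log (1 + A t i) - 1 / (1 + A t i) + 1))
            + if i ∈ act (t + 1) then weight (R t i) (A t i) * r (t + 1) i else 0 := by
        intro i _
        rw [hRS, hAS]
        split_ifs with h
        · have h2 := potential_add_le (hRA t i) (hr _ hmem i h)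
          have h3 := div_add_one_le (hA0 t i) (abs_nonneg _) (hr _ hmem i h)
          linarith
        · simp
      have h2 := Finset.sum_le_sum h1
      rw [Finset.sum_add_distrib, Finset.sum_ite_mem, Finset.inter_eq_right.2 (hact _ hmem)] at h2
      have h3 := hw _ hmem
      rw [Nat.add_sub_cancel] at h3
      linarith [ih (by omega)]
  have h1 := key s le_rfl
  rw [Finset.sum_sub_distrib] at h1
  have h2 : ∑ i ∈ I, 3 / 2 * (Real.log (1 + A s i) - 1 / (1 + A s i) + 1)
      ≤ ∑ i ∈ I, 3 / 2 * (Real.log (1 + s) + 1) := by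
    refine Finset.sum_le_sum fun i _ => ?_
    have h3 : Real.log (1 + A s i) ≤ Real.log (1 + s) :=
      Real.log_le_log (by linarith [hA0 s i]) (by linarith [hAs i])
    have h4 : 0 ≤ 1 / (1 + A s i) := by have := hA0 s i; positivity
    linarith
  rw [Finset.sum_const, nsmul_eq_mul] at h2
  have h3 : potential (R s i) (A s i) ≤ ∑ i ∈ I, potential (R s i) (A s i) :=
    Finset.single_le_sum (fun i _ => (potential_pos _ _).le) hi
  linarith

/-! ### Smooth functions -/

/-- The descent lemma. Only gradient differences from the base point x enter, so x + v may leave W.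
-/
theorem SmoothAround.le_quadratic {d : ℕ} {H : ℝ} {W : Set (E d)} {f : E d → ℝ}
    (hf : SmoothAround H W f) {x : E d} (hx : x ∈ W) (v : E d) :
    f (x + v) ≤ f x + inner ℝ (gradient f x) v + H / 2 * ‖v‖ ^ 2 := by
  have hder : ∀ u : ℝ, HasDerivAt (fun u : ℝ => f (x + u • v)
      - (u * inner ℝ (gradient f x) v + H / 2 * ‖v‖ ^ 2 * u ^ 2))
      (inner ℝ (gradient f (x + u • v)) v
        - (1 * inner ℝ (gradient f x) v + H / 2 * ‖v‖ ^ 2 * (2 * u))) u := by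
    intro u
    have h1 : HasDerivAt (fun u : ℝ => x + u • v) v u := by
      simpa using ((hasDerivAt_id u).smul_const v).const_add x
    have h2 := ((hf.1 (x + u • v)).hasFDerivAt).comp_hasDerivAt u h1
    rw [← inner_gradient_left] at h2
    refine h2.sub (((hasDerivAt_id u).mul_const _).add ?_)
    simpa using (hasDerivAt_pow 2 u).const_mul (H / 2 * ‖v‖ ^ 2)
  have hanti : AntitoneOn (fun u : ℝ => f (x + u • v)
      - (u * inner ℝ (gradient f x) v + H / 2 * ‖v‖ ^ 2 * u ^ 2)) (Set.Icc 0 1) := by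
    refine antitoneOn_of_deriv_nonpos (convex_Icc 0 1)
      (fun u _ => (hder u).continuousAt.continuousWithinAt)
      (fun u _ => (hder u).differentiableAt.differentiableWithinAt) fun u hu => ?_
    rw [(hder u).deriv]
    have hu0 : 0 ≤ u := (interior_subset hu).1
    have h1 : inner ℝ (gradient f (x + u • v) - gradient f x) v ≤ H * (u * ‖v‖) * ‖v‖ := by
      refine (real_inner_le_norm _ _).trans ?_
      gcongr
      have := hf.2 x hx (x + u • v)
      rw [norm_sub_rev] at this
      refine this.trans_eq ?_
      simp [norm_smul, abs_of_nonneg hu0]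
    rw [inner_sub_left] at h1
    linarith
  have := hanti (Set.left_mem_Icc.2 zero_le_one) (Set.right_mem_Icc.2 zero_le_one) zero_le_one
  simp only [one_smul, zero_smul, add_zero] at this
  linarith

/-- A gradient step cannot make f negative. The step may leave W, which is why nonnegativity is
required on the whole space. -/
theorem SmoothAround.norm_gradient_sq_le {d : ℕ} {H : ℝ} {W : Set (E d)} {f : E d → ℝ}
    (hH : 0 ≤ H) (hf : SmoothAround H W f) (hf0 : ∀ x, 0 ≤ f x) {x : E d} (hx : x ∈ W) :
    ‖gradient f x‖ ^ 2 ≤ 2 * H * f x := by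
  have key : ∀ η : ℝ, 0 ≤ f x - η * ‖gradient f x‖ ^ 2 + H / 2 * η ^ 2 * ‖gradient f x‖ ^ 2 := by
    intro η
    have h1 := hf.le_quadratic hx (-η • gradient f x)
    have h2 := hf0 (x + -η • gradient f x)
    rw [inner_smul_right, real_inner_self_eq_norm_sq, norm_smul, mul_pow, Real.norm_eq_abs,
      sq_abs] at h1
    nlinarith
  rcases hH.eq_or_lt with rfl | hH
  · by_contra! h
    simp only [mul_zero, zero_mul] at h
    -- For H = 0 the bound is linear in η, and this step would bring it down to -1.
    have h1 := key ((f x + 1) / ‖gradient f x‖ ^ 2)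
    rw [div_mul_cancel₀ _ h.ne'] at h1
    linarith
  · have h1 := key (1 / H)
    have h2 : f x - 1 / H * ‖gradient f x‖ ^ 2 + H / 2 * (1 / H) ^ 2 * ‖gradient f x‖ ^ 2
        = (2 * H * f x - ‖gradient f x‖ ^ 2) / (2 * H) := by
      field_simp
      ring
    rw [h2] at h1
    have := (le_div_iff₀ (by positivity)).1 h1
    linarith

theorem convexOn_sub_le_inner_gradient {d : ℕ} {W : Set (E d)} {f : E d → ℝ}
    (hf : ConvexOn ℝ W f) (hd : Differentiable ℝ f) {x w : E d} (hx : x ∈ W) (hw : w ∈ W) :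
    f x - f w ≤ inner ℝ (gradient f x) (x - w) := by
  have h1 : HasDerivAt (fun u : ℝ => x + u • (w - x)) (w - x) 0 := by
    simpa using ((hasDerivAt_id (0 : ℝ)).smul_const (w - x)).const_add x
  have h2 := ((hd (x + (0 : ℝ) • (w - x))).hasFDerivAt).comp_hasDerivAt 0 h1
  rw [← inner_gradient_left, zero_smul, add_zero] at h2
  have h3 : ∀ u ∈ Set.Ioo (0 : ℝ) 1,
      slope (f ∘ fun u : ℝ => x + u • (w - x)) 0 u ≤ f w - f x := by
    intro u hu
    have h4 := hf.2 hx hw (show 0 ≤ 1 - u by linarith [hu.2]) hu.1.le (by ring)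
    have h5 : x + u • (w - x) = (1 - u) • x + u • w := by
      rw [smul_sub, sub_smul, one_smul]; abel
    rw [slope_def_field, div_le_iff₀ (by linarith [hu.1])]
    simp only [Function.comp, zero_smul, add_zero, h5]
    simp only [smul_eq_mul] at h4
    linarith
  have h6 : inner ℝ (gradient f x) (w - x) ≤ f w - f x := by
    refine le_of_tendsto ((hasDerivAt_iff_tendsto_slope.1 h2).mono_left
      (nhdsWithin_mono 0 (fun u (hu : u ∈ Set.Ioi (0 : ℝ)) => ne_of_gt hu))) ?_
    filter_upwards [Ioo_mem_nhdsGT (zero_lt_one' ℝ)] with u hu using h3 u hu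
  have h7 : inner ℝ (gradient f x) (x - w) = - inner ℝ (gradient f x) (w - x) := by
    rw [← inner_neg_right, neg_sub]
  linarith

/-! ### Projections -/

theorem proj_spec {d : ℕ} {W : Set (E d)} (hne : W.Nonempty) (hc : IsClosed W) (hW : Convex ℝ W)
    (x : E d) : proj W x ∈ W ∧ ∀ q ∈ W, ‖x - proj W x‖ ≤ ‖x - q‖ := by
  refine Classical.epsilon_spec (p := fun p => p ∈ W ∧ ∀ q ∈ W, ‖x - p‖ ≤ ‖x - q‖) ?_
  obtain ⟨p, hp, h⟩ := exists_norm_eq_iInf_of_complete_convex hne hc.isComplete hW x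
  refine ⟨p, hp, fun q hq => ?_⟩
  rw [h]
  exact ciInf_le ⟨0, by rintro _ ⟨y, rfl⟩; exact norm_nonneg _⟩ (⟨q, hq⟩ : W)

theorem norm_proj_sub_sq_le {d : ℕ} {W : Set (E d)} (hc : IsClosed W) (hW : Convex ℝ W)
    (x : E d) {w : E d} (hw : w ∈ W) : ‖proj W x - w‖ ^ 2 ≤ ‖x - w‖ ^ 2 := by
  obtain ⟨h1, h2⟩ := proj_spec ⟨w, hw⟩ hc hW x
  have : Nonempty W := ⟨⟨w, hw⟩⟩
  have h3 : ‖x - proj W x‖ = ⨅ q : W, ‖x - q‖ := by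
    refine le_antisymm (le_ciInf fun q => h2 q q.2) ?_
    exact ciInf_le ⟨0, by rintro _ ⟨y, rfl⟩; exact norm_nonneg _⟩ (⟨_, h1⟩ : W)
  have h4 := (norm_eq_iInf_iff_real_inner_le_zero hW h1).1 h3 w hw
  have h5 : x - w = (x - proj W x) - (w - proj W x) := by abel
  rw [h5, norm_sub_sq_real (x - proj W x), norm_sub_rev (proj W x) w]
  nlinarith [sq_nonneg ‖x - proj W x‖]

/-! ### Regret of scale-free online gradient descent -/

/-- An instance of SOGD that starts at `x` and receives `g 0, g 1, …`. -/
noncomputable def SOGD.run {d : ℕ} (W : Set (E d)) (α δ : ℝ) (g : ℕ → E d → ℝ) (x : E d) : ℕ → SOGD d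
  | 0 => SOGD.new x
  | k + 1 => (SOGD.run W α δ g x k).step W α δ (g k)

section SOGD

variable {d : ℕ} {W : Set (E d)} {α δ D H : ℝ} {g : ℕ → E d → ℝ} {x : E d}

theorem SOGD.run_mem (hc : IsClosed W) (hW : Convex ℝ W) (hx : x ∈ W) (k : ℕ) :
    (SOGD.run W α δ g x k).w ∈ W := by
  cases k with
  | zero => exact hx
  | succ k => exact (proj_spec ⟨x, hx⟩ hc hW _).1

theorem SOGD.run_G_nonneg (k : ℕ) : 0 ≤ (SOGD.run W α δ g x k).G := by
  induction k with
  | zero => exact le_rfl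
  | succ k ih => exact add_nonneg ih (sq_nonneg _)

theorem SOGD.run_G_le (hH : 0 ≤ H) (hc : IsClosed W) (hW : Convex ℝ W) (hx : x ∈ W) (k : ℕ)
    (hg : ∀ j < k, SmoothAround H W (g j) ∧ ∀ y, 0 ≤ g j y) :
    (SOGD.run W α δ g x k).G
      ≤ 2 * H * ∑ j ∈ Finset.range k, g j (SOGD.run W α δ g x j).w := by
  induction k with
  | zero => simp [SOGD.run, SOGD.new]
  | succ k ih =>
    rw [Finset.sum_range_succ, mul_add]
    exact add_le_add (ih fun j hj => hg j (by omega))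
      ((hg k (by omega)).1.norm_gradient_sq_le hH (hg k (by omega)).2 (run_mem hc hW hx k))

/-- The right-hand side is a potential that survives a change of step size: D² - ‖w_k - w‖² is
nonnegative, so its coefficient may grow with the square root. -/
theorem SOGD.sum_inner_le (hα : 0 < α) (hδ : 0 < δ) (hc : IsClosed W) (hW : Convex ℝ W)
    (hD : ∀ x ∈ W, ∀ y ∈ W, ‖x - y‖ ≤ D) (hx : x ∈ W) {w : E d} (hw : w ∈ W) (k : ℕ) :
    ∑ j ∈ Finset.range k, inner ℝ (gradient (g j) (SOGD.run W α δ g x j).w)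
        ((SOGD.run W α δ g x j).w - w)
      ≤ √(δ + (SOGD.run W α δ g x k).G) / (2 * α) * (D ^ 2 - ‖(SOGD.run W α δ g x k).w - w‖ ^ 2)
        + α * √(δ + (SOGD.run W α δ g x k).G) := by
  induction k with
  | zero =>
    have h1 := hD _ (run_mem (α := α) (δ := δ) (g := g) hc hW hx 0) w hw
    have h2 : ‖(SOGD.run W α δ g x 0).w - w‖ ^ 2 ≤ D ^ 2 := by gcongr
    have h3 : 0 ≤ D ^ 2 - ‖(SOGD.run W α δ g x 0).w - w‖ ^ 2 := by linarith
    simp only [Finset.range_zero, Finset.sum_empty]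
    positivity
  | succ k ih =>
    rw [Finset.sum_range_succ]
    set e := SOGD.run W α δ g x k with he
    set v := gradient (g k) e.w with hv
    have hG : (SOGD.run W α δ g x (k + 1)).G = e.G + ‖v‖ ^ 2 := rfl
    have hstep : (SOGD.run W α δ g x (k + 1)).w
      = proj W (e.w - (α / √(δ + (e.G + ‖v‖ ^ 2))) • v) := rfl
    have hG0 : 0 ≤ e.G := run_G_nonneg k
    rw [hG]
    set S := √(δ + e.G) with hS
    set S' := √(δ + (e.G + ‖v‖ ^ 2)) with hS'
    set y := (SOGD.run W α δ g x (k + 1)).w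
    have hS0 : 0 < S := Real.sqrt_pos.2 (by positivity)
    have hS'0 : 0 < S' := Real.sqrt_pos.2 (by positivity)
    have hSS' : S ≤ S' := Real.sqrt_le_sqrt (by linarith [sq_nonneg ‖v‖])
    have hsq : S' ^ 2 - S ^ 2 = ‖v‖ ^ 2 := by
      rw [hS, hS', Real.sq_sqrt (by positivity), Real.sq_sqrt (by positivity)]; ring
    have hproj : ‖y - w‖ ^ 2 ≤ ‖e.w - w - (α / S') • v‖ ^ 2 := by
      have := norm_proj_sub_sq_le hc hW (e.w - (α / S') • v) hw
      rw [← hstep] at this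
      rwa [show e.w - w - (α / S') • v = e.w - (α / S') • v - w by abel]
    rw [norm_sub_sq_real (e.w - w), inner_smul_right, norm_smul, mul_pow, Real.norm_eq_abs, sq_abs,
      real_inner_comm] at hproj
    have h1 : inner ℝ v (e.w - w) ≤ S' / (2 * α) * (‖e.w - w‖ ^ 2 - ‖y - w‖ ^ 2)
        + α * ‖v‖ ^ 2 / (2 * S') := by
      have h2 : S' / (2 * α) * ‖y - w‖ ^ 2 ≤ S' / (2 * α) *
          (‖e.w - w‖ ^ 2 - 2 * (α / S' * inner ℝ v (e.w - w)) + (α / S') ^ 2 * ‖v‖ ^ 2) := by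
        gcongr
      have h3 : S' / (2 * α) *
          (‖e.w - w‖ ^ 2 - 2 * (α / S' * inner ℝ v (e.w - w)) + (α / S') ^ 2 * ‖v‖ ^ 2)
          = S' / (2 * α) * ‖e.w - w‖ ^ 2 - inner ℝ v (e.w - w) + α * ‖v‖ ^ 2 / (2 * S') := by
        field_simp
      linarith
    -- ‖v‖² = (S' - S)(S' + S), so S' + S ≥ S' suffices for a bound with 2S' once the nonnegative
    -- remaining part is compared; equivalently S'² - S² ≤ 2S'(S' - S) + (S' - S)² is sharpened by
    -- `nlinarith`.
    have h4 : ‖v‖ ^ 2 / (2 * S') ≤ S' - S := by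
      rw [div_le_iff₀ (by positivity), ← hsq]
      nlinarith
    have h5 : α * ‖v‖ ^ 2 / (2 * S') ≤ α * (S' - S) := by
      rw [mul_div_assoc]; gcongr
    have h6 : ‖e.w - w‖ ^ 2 ≤ D ^ 2 := by
      have := hD _ (run_mem (α := α) (δ := δ) (g := g) hc hW hx k) w hw
      gcongr
    have h7 : S / (2 * α) * (D ^ 2 - ‖e.w - w‖ ^ 2) ≤ S' / (2 * α) * (D ^ 2 - ‖e.w - w‖ ^ 2) := by
      have : 0 ≤ D ^ 2 - ‖e.w - w‖ ^ 2 := by linarith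
      gcongr
    linarith

theorem SOGD.regret_le (hH : 0 ≤ H) (hD0 : 0 < D) (hδ : 0 < δ) (hc : IsClosed W)
    (hW : Convex ℝ W) (hD : ∀ x ∈ W, ∀ y ∈ W, ‖x - y‖ ≤ D) (hx : x ∈ W) {w : E d} (hw : w ∈ W)
    (k : ℕ) (hg : ∀ j < k, SmoothAround H W (g j) ∧ (∀ y, 0 ≤ g j y) ∧ ConvexOn ℝ W (g j)) :
    ∑ j ∈ Finset.range k, g j (SOGD.run W (D / √2) δ g x j).w
        - ∑ j ∈ Finset.range k, g j w
      ≤ √(4 * (H * D ^ 2) * ∑ j ∈ Finset.range k, g j (SOGD.run W (D / √2) δ g x j).w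
          + (D * √(2 * δ)) ^ 2) := by
  have h2 : 0 < √(2 : ℝ) := by positivity
  have hs2 : √(2 : ℝ) ^ 2 = 2 := Real.sq_sqrt (by norm_num)
  have hα : 0 < D / √2 := by positivity
  rw [← Finset.sum_sub_distrib]
  have h3 : ∑ j ∈ Finset.range k, (g j (SOGD.run W (D / √2) δ g x j).w - g j w)
      ≤ ∑ j ∈ Finset.range k, inner ℝ (gradient (g j) (SOGD.run W (D / √2) δ g x j).w)
        ((SOGD.run W (D / √2) δ g x j).w - w) :=
    Finset.sum_le_sum fun j hj => by
      have := hg j (Finset.mem_range.1 hj)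
      exact convexOn_sub_le_inner_gradient this.2.2 this.1.1 (run_mem hc hW hx j) hw
  have h4 := sum_inner_le (g := g) hα hδ hc hW hD hx hw k
  have h5 := run_G_le (α := D / √2) (δ := δ) hH hc hW hx k
    fun j hj => ⟨(hg j hj).1, (hg j hj).2.1⟩
  have h0 := run_G_nonneg (W := W) (α := D / √2) (δ := δ) (g := g) (x := x) k
  set G := (SOGD.run W (D / √2) δ g x k).G
  refine h3.trans (h4.trans ?_)
  have h6 : √(δ + G) / (2 * (D / √2)) * (D ^ 2 - ‖(SOGD.run W (D / √2) δ g x k).w - w‖ ^ 2)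
      ≤ √(δ + G) / (2 * (D / √2)) * D ^ 2 := by
    gcongr
    linarith [sq_nonneg ‖(SOGD.run W (D / √2) δ g x k).w - w‖]
  -- α = D/√2 minimizes D²/(2α) + α; the minimum is √2 D.
  have h7 : √(δ + G) / (2 * (D / √2)) * D ^ 2 + D / √2 * √(δ + G) = √2 * D * √(δ + G) := by
    field_simp
    rw [hs2]
    ring
  refine (add_le_add_left h6 _).trans ?_
  rw [h7]
  apply Real.le_sqrt_of_sq_le
  rw [mul_pow, mul_pow, mul_pow, hs2, Real.sq_sqrt (by positivity), Real.sq_sqrt (by positivity)]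
  have : D ^ 2 * G ≤ D ^ 2 * (2 * H * ∑ j ∈ Finset.range k, g j (SOGD.run W (D / √2) δ g x j).w) := by
    gcongr
  linarith

end SOGD

/-- From the implicit regret bound of SOGD to the bound in terms of the comparator. -/
theorem sub_le_of_sub_le_sqrt {h q x y : ℝ} (hh : 0 ≤ h) (hq : 0 ≤ q) (hx : 0 ≤ x) (hy : 0 ≤ y)
    (hxy : x - y ≤ √(4 * h * x + q ^ 2)) : x - y ≤ 4 * h + q + √(4 * h * y) := by
  rcases le_total (x - y) 0 with h0 | h0
  · have := Real.sqrt_nonneg (4 * h * y)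
    linarith
  have h1 : (x - y) ^ 2 ≤ 4 * h * x + q ^ 2 := by
    rw [← Real.sq_sqrt (show 0 ≤ 4 * h * x + q ^ 2 by positivity)]
    gcongr
  -- Writing x = (x - y) + y gives a quadratic inequality in x - y.
  have h2 := le_add_sqrt_of_sq_le (z := x - y) (a := 4 * h) (m := 4 * h * y + q ^ 2)
    (by positivity) (by linarith)
  have h3 : √(4 * h * y + q ^ 2) ≤ √(4 * h * y) + q := by
    rw [Real.sqrt_le_left (by positivity)]
    have := Real.sq_sqrt (show 0 ≤ 4 * h * y by positivity)
    nlinarith [Real.sqrt_nonneg (4 * h * y)]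
  linarith

/-- The purpose of the threshold: an expert that has lost C certifies that every comparator has lost
C/4. By AM-GM, √(4hx) ≤ 4h + x/4, and C absorbs the constants. -/
theorem quarter_le_of_sub_le_sqrt {h q x y C : ℝ} (hh : 0 ≤ h) (hq : 0 ≤ q)
    (hC : 20 * h + 2 * q ≤ C) (hx : C ≤ x)
    (hxy : x - y ≤ √(4 * h * x + q ^ 2)) : C / 4 ≤ y := by
  have hx0 : 0 ≤ x := by linarith
  have h3 : √(4 * h * x + q ^ 2) ≤ 4 * h + x / 4 + q := by
    rw [Real.sqrt_le_left (by positivity)]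
    nlinarith [sq_nonneg (4 * h - x / 4), mul_nonneg hh hq, mul_nonneg hx0 hq]
  linarith

/-! ### Invariants of the algorithm -/

theorem lt_endIndex (m : ℕ) : m < endIndex m := by
  have : 0 < 2 ^ padicValNat 2 m := by positivity
  unfold endIndex
  omega

section Algorithm

variable {d : ℕ} (P : Input d) (f : ℕ → E d → ℝ)

/-- The state of the algorithm in round `t`, when the decision is made. -/
noncomputable def roundState (t : ℕ) : State d := (stateAfter P f (t - 1)).create P t

/-- A marker is a round in which an expert is created. -/
def IsMarker (t : ℕ) : Prop := (stateAfter P f (t - 1)).newInterval = true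

noncomputable instance : DecidablePred (IsMarker P f) := fun _ => inferInstanceAs (Decidable (_ = true))

/-- The markers among the first `t` rounds. -/
noncomputable def markers (t : ℕ) : Finset ℕ := (Finset.Icc 1 t).filter (IsMarker P f)

/-- The number of the most recent marker in round `t`. -/
noncomputable def numMarkers (t : ℕ) : ℕ := (markers P f t).card

/-- The decision in round `t` of the expert that is created in round `i`. -/
noncomputable def point (i t : ℕ) : E d :=
  (SOGD.run P.W P.α P.δ (fun k => f (i + k)) (P.init i) (t - i)).w

/-- The instantaneous regret in round `t` with respect to the expert created in round `i`. -/
noncomputable def gap (t i : ℕ) : ℝ := f t (decision P f t) - f t (point P f i t)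

/-- The expert that is created in round `i`, at the beginning of round `t`. -/
noncomputable def expertAt (i t : ℕ) : Expert d where
  alg := SOGD.run P.W P.α P.δ (fun k => f (i + k)) (P.init i) (t - i)
  R := ∑ u ∈ Finset.Ico i t, gap P f u i
  A := ∑ u ∈ Finset.Ico i t, |gap P f u i|
  g := endIndex (numMarkers P f i)

/-- The state of the algorithm in round `t`, described without reference to the other rounds. -/
structure RoundInvariant (t : ℕ) : Prop where
  newInterval_eq : (roundState P f t).newInterval = false
  m_eq : (roundState P f t).m = numMarkers P f t
  one_le_n : 1 ≤ (roundState P f t).n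
  n_le : (roundState P f t).n ≤ t
  isMarker_n : IsMarker P f (roundState P f t).n
  numMarkers_n : numMarkers P f (roundState P f t).n = numMarkers P f t
  mem_active : ∀ i, i ∈ (roundState P f t).active ↔
    1 ≤ i ∧ i ≤ t ∧ IsMarker P f i ∧ numMarkers P f t < endIndex (numMarkers P f i)
  expert_eq : ∀ i ∈ (roundState P f t).active, (roundState P f t).expert i = expertAt P f i t
  L_eq : (roundState P f t).L
    = ∑ u ∈ Finset.Ico (roundState P f t).n t, f u (point P f (roundState P f t).n u)
  L_le : (roundState P f t).L ≤ P.C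

variable {P f}

theorem decision_eq (t : ℕ) : decision P f t = (roundState P f t).decide P t := rfl

theorem stateAfter_eq {t : ℕ} (ht : 1 ≤ t) :
    stateAfter P f t = (roundState P f t).finish P (f t) (decision P f t) := by
  obtain ⟨t, rfl⟩ := Nat.exists_eq_add_of_le' ht
  rfl

theorem isMarker_one : IsMarker P f 1 := rfl

theorem markers_succ_of_isMarker {t : ℕ} (h : IsMarker P f (t + 1)) :
    markers P f (t + 1) = insert (t + 1) (markers P f t) := by
  unfold markers
  rw [← Finset.insert_Icc_right_eq_Icc_add_one (by omega), Finset.filter_insert, if_pos h]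

theorem markers_succ_of_not_isMarker {t : ℕ} (h : ¬ IsMarker P f (t + 1)) :
    markers P f (t + 1) = markers P f t := by
  unfold markers
  rw [← Finset.insert_Icc_right_eq_Icc_add_one (by omega), Finset.filter_insert, if_neg h]

theorem numMarkers_succ_of_isMarker {t : ℕ} (h : IsMarker P f (t + 1)) :
    numMarkers P f (t + 1) = numMarkers P f t + 1 := by
  unfold numMarkers
  rw [markers_succ_of_isMarker h, Finset.card_insert_of_notMem]
  simp [markers]

theorem numMarkers_succ_of_not_isMarker {t : ℕ} (h : ¬ IsMarker P f (t + 1)) :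
    numMarkers P f (t + 1) = numMarkers P f t := by
  unfold numMarkers
  rw [markers_succ_of_not_isMarker h]

theorem numMarkers_mono : Monotone (numMarkers P f) := fun _ _ h =>
  Finset.card_le_card (Finset.filter_subset_filter _ (Finset.Icc_subset_Icc_right h))

theorem one_le_numMarkers {t : ℕ} (ht : 1 ≤ t) : 1 ≤ numMarkers P f t :=
  Finset.card_pos.2 ⟨1, by simp [markers, ht, isMarker_one]⟩

theorem numMarkers_lt {i j : ℕ} (hj : IsMarker P f j) (h : i < j) :
    numMarkers P f i < numMarkers P f j := by
  obtain ⟨j, rfl⟩ := Nat.exists_eq_add_of_le' (show 1 ≤ j by omega)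
  rw [numMarkers_succ_of_isMarker hj]
  exact Nat.lt_succ_of_le (numMarkers_mono (by omega))

theorem isMarker_inj {i j : ℕ} (hi : IsMarker P f i) (hj : IsMarker P f j)
    (h : numMarkers P f i = numMarkers P f j) : i = j := by
  rcases lt_trichotomy i j with h' | h' | h'
  · exact absurd h (numMarkers_lt hj h').ne
  · exact h'
  · exact absurd h (numMarkers_lt hi h').ne'

/-- The count of markers rises by at most one per round, so it skips no value. -/
theorem exists_isMarker {s k : ℕ} (hk : 1 ≤ k) (hks : k ≤ numMarkers P f s) :
    ∃ i, 1 ≤ i ∧ i ≤ s ∧ IsMarker P f i ∧ numMarkers P f i = k := by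
  induction s with
  | zero => simp [numMarkers, markers] at hks; omega
  | succ s ih =>
    by_cases h : k ≤ numMarkers P f s
    · obtain ⟨i, h1, h2, h3⟩ := ih h
      exact ⟨i, h1, by omega, h3⟩
    · by_cases hm : IsMarker P f (s + 1)
      · have := numMarkers_succ_of_isMarker hm
        exact ⟨s + 1, by omega, le_rfl, hm, by omega⟩
      · have := numMarkers_succ_of_not_isMarker hm
        omega

theorem expertAt_self (i : ℕ) :
    expertAt P f i i = ⟨SOGD.new (P.init i), 0, 0, endIndex (numMarkers P f i)⟩ := by
  simp [expertAt, SOGD.run]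

theorem expertAt_succ {i t : ℕ} (h : i ≤ t) :
    expertAt P f i (t + 1) = (expertAt P f i t).update P (f t) (decision P f t) := by
  obtain ⟨k, rfl⟩ := Nat.exists_eq_add_of_le h
  have e1 : i + k + 1 - i = k + 1 := by omega
  simp only [expertAt, Expert.update, Finset.sum_Ico_succ_top h, e1, Nat.add_sub_cancel_left,
    SOGD.run, gap, point]

theorem roundState_succ_of_isMarker {t : ℕ} (h : IsMarker P f (t + 1)) :
    roundState P f (t + 1) =
    { newInterval := false
      m := (stateAfter P f t).m + 1
      n := t + 1
      active := insert (t + 1) (stateAfter P f t).active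
      expert := Function.update (stateAfter P f t).expert (t + 1)
        ⟨SOGD.new (P.init (t + 1)), 0, 0, endIndex ((stateAfter P f t).m + 1)⟩
      L := 0 } := by
  have h' : (stateAfter P f t).newInterval = true := h
  simp [roundState, State.create, h']

theorem roundState_succ_of_not_isMarker {t : ℕ} (h : ¬ IsMarker P f (t + 1)) :
    roundState P f (t + 1) = stateAfter P f t := by
  have h' : ¬ (stateAfter P f t).newInterval = true := h
  simp [roundState, State.create, h']

/-- Serves both round 1 and every later restart. In `hact` the count already includes the new
marker, because experts ending there were removed in the previous round. -/
theorem roundInvariant_of_isMarker (hC : 0 ≤ P.C) {t : ℕ} (h : IsMarker P f (t + 1))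
    (hm : (stateAfter P f t).m = numMarkers P f t)
    (hact : ∀ i, i ∈ (stateAfter P f t).active ↔
      1 ≤ i ∧ i ≤ t ∧ IsMarker P f i ∧ numMarkers P f (t + 1) < endIndex (numMarkers P f i))
    (hexp : ∀ i ∈ (stateAfter P f t).active, (stateAfter P f t).expert i
      = expertAt P f i (t + 1)) :
    RoundInvariant P f (t + 1) := by
  have hn := numMarkers_succ_of_isMarker h
  rw [← hm] at hn
  have e := roundState_succ_of_isMarker h
  constructor
  · rw [e]
  · rw [e, hn]
  · rw [e]; simp
  · rw [e]
  · rw [e]; exact h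
  · rw [e]
  · intro i
    rw [e]
    simp only [Finset.mem_insert, hact]
    constructor
    · rintro (rfl | ⟨h1, h2, h3⟩)
      · exact ⟨by omega, le_rfl, h, lt_endIndex _⟩
      · exact ⟨h1, by omega, h3⟩
    · rintro ⟨h1, h2, h3⟩
      rcases h2.eq_or_lt with h4 | h4
      · exact Or.inl h4
      · exact Or.inr ⟨h1, by omega, h3⟩
  · intro i
    rw [e]
    simp only [Finset.mem_insert]
    intro hi
    rcases eq_or_ne i (t + 1) with rfl | h1
    · rw [Function.update_self, expertAt_self, hn]
    · rw [Function.update_of_ne h1]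
      exact hexp i (hi.resolve_left h1)
  · rw [e]; simp
  · rw [e]; exact hC

theorem RoundInvariant.n_mem_active {t : ℕ} (h : RoundInvariant P f t) :
    (roundState P f t).n ∈ (roundState P f t).active :=
  (h.mem_active _).2 ⟨h.one_le_n, h.n_le, h.isMarker_n, by
    rw [← h.numMarkers_n]; exact lt_endIndex _⟩

theorem RoundInvariant.add_eq {t : ℕ} (h : RoundInvariant P f t) :
    (roundState P f t).L + f t ((roundState P f t).expert (roundState P f t).n).alg.w
      = ∑ u ∈ Finset.Ico (roundState P f t).n (t + 1), f u (point P f (roundState P f t).n u) := by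
  rw [Finset.sum_Ico_succ_top h.n_le, ← h.L_eq, h.expert_eq _ h.n_mem_active]
  rfl

theorem RoundInvariant.isMarker_succ_iff {t : ℕ} (h : RoundInvariant P f t) (ht : 1 ≤ t) :
    IsMarker P f (t + 1) ↔ P.C <
      ∑ u ∈ Finset.Ico (roundState P f t).n (t + 1), f u (point P f (roundState P f t).n u) := by
  unfold IsMarker
  rw [Nat.add_sub_cancel, stateAfter_eq ht, ← h.add_eq]
  simp only [State.finish, h.newInterval_eq]
  split_ifs with h1 <;> simp [h1]

/-- The algorithm only tests whether an expert ends exactly at the next marker. This is enough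
because the numbers of the markers are consecutive. -/
theorem RoundInvariant.mem_active_stateAfter {t : ℕ} (h : RoundInvariant P f t) (ht : 1 ≤ t)
    (i : ℕ) : i ∈ (stateAfter P f t).active ↔
      1 ≤ i ∧ i ≤ t ∧ IsMarker P f i ∧ numMarkers P f (t + 1) < endIndex (numMarkers P f i) := by
  have hiff := h.isMarker_succ_iff ht
  rw [← h.add_eq] at hiff
  rw [stateAfter_eq ht]
  simp only [State.finish]
  by_cases hm : IsMarker P f (t + 1)
  · rw [if_pos (hiff.1 hm), Finset.mem_filter, numMarkers_succ_of_isMarker hm]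
    constructor
    · rintro ⟨h1, h2⟩
      rw [h.expert_eq i h1, h.m_eq] at h2
      obtain ⟨h3, h4, h5, h6⟩ := (h.mem_active i).1 h1
      exact ⟨h3, h4, h5, lt_of_le_of_ne h6 (Ne.symm h2)⟩
    · rintro ⟨h3, h4, h5, h6⟩
      have h1 := (h.mem_active i).2 ⟨h3, h4, h5, by omega⟩
      refine ⟨h1, ?_⟩
      rw [h.expert_eq i h1, h.m_eq]
      exact h6.ne'
  · rw [if_neg (fun h1 => hm (hiff.2 h1)), numMarkers_succ_of_not_isMarker hm, h.mem_active]

theorem RoundInvariant.succ (hC : 0 ≤ P.C) {t : ℕ} (h : RoundInvariant P f t) (ht : 1 ≤ t) :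
    RoundInvariant P f (t + 1) := by
  have hact := h.mem_active_stateAfter ht
  have hm : (stateAfter P f t).m = (roundState P f t).m := by rw [stateAfter_eq ht]; rfl
  have hn : (stateAfter P f t).n = (roundState P f t).n := by rw [stateAfter_eq ht]; rfl
  have hL : (stateAfter P f t).L
      = ∑ u ∈ Finset.Ico (roundState P f t).n (t + 1), f u (point P f (roundState P f t).n u) := by
    rw [stateAfter_eq ht, ← h.add_eq]; rfl
  have hexp : ∀ i ∈ (stateAfter P f t).active, (stateAfter P f t).expert i
      = expertAt P f i (t + 1) := by
    intro i hi
    have h1 := (hact i).1 hi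
    have h2 : i ∈ (roundState P f t).active :=
      (h.mem_active i).2 ⟨h1.1, h1.2.1, h1.2.2.1,
        (numMarkers_mono (Nat.le_succ t)).trans_lt h1.2.2.2⟩
    rw [expertAt_succ h1.2.1, ← h.expert_eq i h2]
    rw [stateAfter_eq ht] at hi ⊢
    exact if_pos hi
  have hiff := h.isMarker_succ_iff ht
  by_cases hmk : IsMarker P f (t + 1)
  · exact roundInvariant_of_isMarker hC hmk (hm.trans h.m_eq) hact hexp
  · have e := roundState_succ_of_not_isMarker hmk
    have hnum := numMarkers_succ_of_not_isMarker hmk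
    constructor
    · rw [e]; simpa [IsMarker] using hmk
    · rw [e, hm, h.m_eq, hnum]
    · rw [e, hn]; exact h.one_le_n
    · rw [e, hn]; exact h.n_le.trans (Nat.le_succ t)
    · rw [e, hn]; exact h.isMarker_n
    · rw [e, hn, hnum]; exact h.numMarkers_n
    · intro i
      rw [e, hact]
      refine ⟨fun ⟨h1, h2, h3⟩ => ⟨h1, by omega, h3⟩, fun ⟨h1, h2, h3, h4⟩ => ⟨h1, ?_, h3, h4⟩⟩
      rcases h2.eq_or_lt with rfl | h2
      · exact absurd h3 hmk
      · omega
    · intro i hi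
      rw [e] at hi ⊢
      exact hexp i hi
    · rw [e, hL, hn]
    · rw [e, hL]
      exact not_lt.1 fun h1 => hmk (hiff.2 h1)

theorem roundInvariant (hC : 0 ≤ P.C) {t : ℕ} (ht : 1 ≤ t) : RoundInvariant P f t := by
  induction t, ht using Nat.le_induction with
  | base =>
    refine roundInvariant_of_isMarker hC isMarker_one ?_ ?_ ?_
    · simp [stateAfter, State.start, numMarkers, markers]
    · intro i
      simp only [stateAfter, State.start, Finset.notMem_empty, false_iff]
      omega
    · intro i hi
      simp [stateAfter, State.start] at hi
  | succ t ht ih => exact ih.succ hC ht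

/-- The experts that are active in round `t`. -/
theorem mem_active_iff (hC : 0 ≤ P.C) {t : ℕ} (ht : 1 ≤ t) {i : ℕ} :
    i ∈ (roundState P f t).active ↔
      1 ≤ i ∧ i ≤ t ∧ IsMarker P f i ∧ numMarkers P f t < endIndex (numMarkers P f i) :=
  (roundInvariant hC ht).mem_active i

theorem n_eq_of_numMarkers_eq (hC : 0 ≤ P.C) {t i : ℕ} (ht : 1 ≤ t) (hi : IsMarker P f i)
    (h : numMarkers P f i = numMarkers P f t) : (roundState P f t).n = i :=
  have inv := roundInvariant (P := P) (f := f) hC ht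
  isMarker_inj inv.isMarker_n hi (inv.numMarkers_n.trans h.symm)

/-- The cumulative loss of an expert exceeds the threshold when the next expert is created. -/
theorem lt_sum_of_isMarker (hC : 0 ≤ P.C) {i j : ℕ} (h1 : 1 ≤ i) (hi : IsMarker P f i)
    (hj : IsMarker P f j) (hij : numMarkers P f j = numMarkers P f i + 1) :
    P.C < ∑ u ∈ Finset.Ico i j, f u (point P f i u) := by
  have hlt : i < j := by
    by_contra! h
    have := numMarkers_mono (P := P) (f := f) h
    omega
  obtain ⟨j, rfl⟩ := Nat.exists_eq_add_of_le' (show 1 ≤ j by omega)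
  have h2 := numMarkers_succ_of_isMarker hj
  have hn := n_eq_of_numMarkers_eq hC (t := j) (by omega) hi (by omega)
  have h3 := ((roundInvariant (P := P) (f := f) hC (t := j) (by omega)).isMarker_succ_iff
    (by omega)).1 hj
  rwa [hn] at h3

/-- Before its last round, the cumulative loss of the latest expert is below the threshold. -/
theorem sum_le_of_numMarkers_eq (hC : 0 ≤ P.C) {i t : ℕ} (ht : 1 ≤ t) (hi : IsMarker P f i)
    (h : numMarkers P f i = numMarkers P f t) :
    ∑ u ∈ Finset.Ico i t, f u (point P f i u) ≤ P.C := by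
  have inv := roundInvariant (P := P) (f := f) hC ht
  have h1 := inv.L_le
  rwa [inv.L_eq, n_eq_of_numMarkers_eq hC ht hi h] at h1

end Algorithm

/-! ### Covering intervals and the doubly logarithmic term -/

/-- With m = 2^p q and q odd, the end is 2^p (q + 1), and q + 1 is even. So each hop to the end of
an interval gains a factor 2 in divisibility, and the guaranteed hop length doubles. -/
theorem endIndex_spec {m k : ℕ} (hm : 0 < m) (h : 2 ^ k ∣ m) :
    m + 2 ^ k ≤ endIndex m ∧ 2 ^ (k + 1) ∣ endIndex m := by
  have : Fact (Nat.Prime 2) := ⟨Nat.prime_two⟩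
  have hk : k ≤ padicValNat 2 m := (padicValNat_dvd_iff_le hm.ne').1 h
  refine ⟨Nat.add_le_add_left (Nat.pow_le_pow_right two_pos hk) m, ?_⟩
  refine (pow_dvd_pow 2 (Nat.succ_le_succ hk)).trans ?_
  obtain ⟨q, hq⟩ := pow_padicValNat_dvd (p := 2) (n := m)
  have hodd : Odd q := by
    by_contra hq'
    obtain ⟨l, hl⟩ := (Nat.not_odd_iff_even.1 hq').two_dvd
    refine pow_succ_padicValNat_not_dvd (p := 2) hm.ne' ⟨l, ?_⟩
    rw [pow_succ, mul_assoc, ← hl, ← hq]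
  obtain ⟨l, hl⟩ := hodd.add_one.two_dvd
  refine ⟨l, ?_⟩
  calc endIndex m = 2 ^ padicValNat 2 m * (q + 1) := by
        rw [mul_add, mul_one, ← hq]; rfl
    _ = 2 ^ (padicValNat 2 m + 1) * l := by rw [hl, pow_succ]; ring

theorem logLog_nonneg (t : ℕ) : 0 ≤ logLog t := by
  have : 0 ≤ Real.log (1 + t) := Real.log_nonneg (by linarith [(Nat.cast_nonneg t : (0 : ℝ) ≤ t)])
  exact Real.log_nonneg (by linarith)

theorem logLog_mono {s t : ℕ} (h : s ≤ t) : logLog s ≤ logLog t := by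
  have h0 : (0 : ℝ) ≤ s := Nat.cast_nonneg s
  have : 0 ≤ Real.log (1 + s) := Real.log_nonneg (by linarith)
  unfold logLog
  gcongr

/-- The assumptions of the regret bound. -/
structure Assumptions {d : ℕ} (H D : ℝ) (T : ℕ) (P : Input d) (f : ℕ → E d → ℝ) : Prop where
  H_nonneg : 0 ≤ H
  D_pos : 0 < D
  δ_pos : 0 < P.δ
  α_eq : P.α = D / √2
  le_C : 20 * (H * D ^ 2) + 2 * (D * √(2 * P.δ)) ≤ P.C
  isClosed : IsClosed P.W
  convex : Convex ℝ P.W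
  norm_sub_le : ∀ x ∈ P.W, ∀ y ∈ P.W, ‖x - y‖ ≤ D
  init_mem : ∀ t, P.init t ∈ P.W
  fallback_mem : ∀ t, P.fallback t ∈ P.W
  convexOn : ∀ t ∈ Finset.Icc 1 T, ConvexOn ℝ P.W (f t)
  nonneg : ∀ t ∈ Finset.Icc 1 T, ∀ x, 0 ≤ f t x
  smooth : ∀ t ∈ Finset.Icc 1 T, SmoothAround H P.W (f t)
  le_one : ∀ t ∈ Finset.Icc 1 T, ∀ x ∈ P.W, f t x ≤ 1

/-- The quantity `c̃`. -/
noncomputable def logTerm {d : ℕ} (P : Input d) (f : ℕ → E d → ℝ) (t : ℕ) : ℝ :=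
  3 * Real.log (numMarkers P f t) + 3 * logLog t

/-! ### Regret bounds for the algorithm -/

section Bounds

variable {d : ℕ} {P : Input d} {f : ℕ → E d → ℝ}

theorem logTerm_nonneg (t : ℕ) : 0 ≤ logTerm P f t := by
  have h1 := Real.log_natCast_nonneg (numMarkers P f t)
  have h2 := logLog_nonneg t
  unfold logTerm
  positivity

theorem logTerm_mono {s t : ℕ} (hs : 1 ≤ s) (h : s ≤ t) : logTerm P f s ≤ logTerm P f t := by
  have h1 := logLog_mono h
  have h2 : Real.log (numMarkers P f s) ≤ Real.log (numMarkers P f t) :=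
    Real.log_le_log (by exact_mod_cast one_le_numMarkers hs) (by exact_mod_cast numMarkers_mono h)
  unfold logTerm
  linarith

variable {H D : ℝ} {T : ℕ}

theorem Assumptions.h_nonneg (h : Assumptions H D T P f)
    : 0 ≤ H * D ^ 2 := mul_nonneg h.H_nonneg (sq_nonneg D)

theorem Assumptions.q_pos (h : Assumptions H D T P f) : 0 < D * √(2 * P.δ) :=
  mul_pos h.D_pos (Real.sqrt_pos.2 (by linarith [h.δ_pos]))

theorem Assumptions.C_pos (h : Assumptions H D T P f)
    : 0 < P.C := by linarith [h.h_nonneg, h.q_pos, h.le_C]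

theorem Assumptions.point_mem (h : Assumptions H D T P f) (i t : ℕ) : point P f i t ∈ P.W :=
  SOGD.run_mem h.isClosed h.convex (h.init_mem i) _

theorem Assumptions.expert_mem (h : Assumptions H D T P f)
    {t : ℕ} (ht : 1 ≤ t) {i : ℕ} (hi : i ∈ (roundState P f t).active) :
    ((roundState P f t).expert i).alg.w = point P f i t := by
  rw [(roundInvariant h.C_pos.le ht).expert_eq i hi]; rfl

theorem Assumptions.expert_weight_nonneg (h : Assumptions H D T P f) {t : ℕ} (ht : 1 ≤ t) :
    ∀ i ∈ (roundState P f t).active,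
      0 ≤ weight ((roundState P f t).expert i).R ((roundState P f t).expert i).A := by
  intro i hi
  rw [(roundInvariant h.C_pos.le ht).expert_eq i hi]
  exact weight_nonneg (A := ∑ u ∈ Finset.Ico i t, |gap P f u i|)
    (Finset.sum_nonneg fun u _ => abs_nonneg _)

theorem Assumptions.decision_mem (h : Assumptions H D T P f)
    {t : ℕ} (ht : 1 ≤ t) : decision P f t ∈ P.W := by
  rw [decision_eq]
  unfold State.decide
  have hw := h.expert_weight_nonneg ht
  simp only
  split_ifs with h0
  · exact h.fallback_mem t
  · refine h.convex.sum_mem (fun i hi => div_nonneg (hw i hi) (Finset.sum_nonneg hw)) ?_ ?_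
    · rw [← Finset.sum_div, div_self h0]
    · intro i hi
      rw [h.expert_mem ht hi]
      exact h.point_mem i t

/-- Jensen's inequality for the weighted average. If all weights vanish, the sum is 0 whatever the
fallback decision. -/
theorem Assumptions.sum_weight_mul_gap_le (h : Assumptions H D T P f)
    {t : ℕ} (ht : t ∈ Finset.Icc 1 T) :
    ∑ i ∈ (roundState P f t).active,
      weight (expertAt P f i t).R (expertAt P f i t).A * gap P f t i ≤ 0 := by
  have ht1 := (Finset.mem_Icc.1 ht).1
  have hexp := (roundInvariant (f := f) h.C_pos.le ht1).expert_eq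
  have hw := h.expert_weight_nonneg ht1
  have e : ∑ i ∈ (roundState P f t).active,
      weight (expertAt P f i t).R (expertAt P f i t).A * gap P f t i
      = ∑ i ∈ (roundState P f t).active, weight ((roundState P f t).expert i).R
        ((roundState P f t).expert i).A * gap P f t i :=
    Finset.sum_congr rfl fun i hi => by rw [hexp i hi]
  rw [e]
  by_cases h0 : ∑ i ∈ (roundState P f t).active, weight ((roundState P f t).expert i).R
        ((roundState P f t).expert i).A = 0
  · have h1 := (Finset.sum_eq_zero_iff_of_nonneg hw).1 h0
    exact (Finset.sum_eq_zero fun i hi => by rw [h1 i hi, zero_mul]).le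
  · have hS : 0 < ∑ i ∈ (roundState P f t).active, weight ((roundState P f t).expert i).R
        ((roundState P f t).expert i).A := (Finset.sum_nonneg hw).lt_of_ne' h0
    have hd : decision P f t = ∑ i ∈ (roundState P f t).active,
        (weight ((roundState P f t).expert i).R ((roundState P f t).expert i).A
        / ∑ j ∈ (roundState P f t).active, weight ((roundState P f t).expert j).R
        ((roundState P f t).expert j).A) • point P f i t := by
      rw [decision_eq]
      unfold State.decide
      simp only
      rw [if_neg h0]
      exact Finset.sum_congr rfl fun i hi => by rw [h.expert_mem ht1 hi]
    have hJ := (h.convexOn t ht).map_sum_le (t := (roundState P f t).active)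
      (w := fun i => weight ((roundState P f t).expert i).R ((roundState P f t).expert i).A
        / ∑ j ∈ (roundState P f t).active, weight ((roundState P f t).expert j).R
        ((roundState P f t).expert j).A) (p := fun i => point P f i t)
      (fun i hi => div_nonneg (hw i hi) hS.le) (by rw [← Finset.sum_div, div_self h0])
      (fun i _ => h.point_mem i t)
    rw [← hd] at hJ
    simp only [smul_eq_mul, div_mul_eq_mul_div] at hJ
    rw [← Finset.sum_div, le_div_iff₀ hS] at hJ
    simp only [gap, mul_sub, Finset.sum_sub_distrib]
    rw [← Finset.sum_mul]
    linarith

theorem Assumptions.abs_gap_le (h : Assumptions H D T P f)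
    {t : ℕ} (ht : t ∈ Finset.Icc 1 T) (i : ℕ) : |gap P f t i| ≤ 1 := by
  have h1 := h.nonneg t ht (decision P f t)
  have h2 := h.le_one t ht _ (h.decision_mem (Finset.mem_Icc.1 ht).1)
  have h3 := h.nonneg t ht (point P f i t)
  have h4 := h.le_one t ht _ (h.point_mem i t)
  unfold gap
  rw [abs_le]
  constructor <;> linarith

/-- An expert that is active in round t has been active ever since its creation, so the
sleeping-expert sums become sums over an interval. -/
theorem Assumptions.sum_ite_active (h : Assumptions H D T P f)
    {t k i : ℕ} (hk : k ≤ t) (hi : i ∈ (roundState P f t).active)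
    (ht : 1 ≤ t) (F : ℕ → ℝ) :
    (∑ u ∈ Finset.Icc 1 k, if i ∈ (roundState P f u).active then F u else 0)
      = ∑ u ∈ Finset.Ico i (k + 1), F u := by
  have hC := h.C_pos.le
  obtain ⟨h1, h2, h3, h4⟩ := (mem_active_iff hC ht).1 hi
  rw [← Finset.sum_filter]
  refine Finset.sum_congr ?_ fun _ _ => rfl
  ext u
  simp only [Finset.mem_filter, Finset.mem_Icc, Finset.mem_Ico]
  constructor
  · rintro ⟨⟨h5, h6⟩, h7⟩
    exact ⟨((mem_active_iff hC h5).1 h7).2.1, by omega⟩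
  · rintro ⟨h5, h6⟩
    exact ⟨⟨by omega, by omega⟩, (mem_active_iff hC (by omega)).2
      ⟨h1, h5, h3, (numMarkers_mono (by omega)).trans_lt h4⟩⟩

/-- The regret with respect to an active expert. -/
theorem Assumptions.regret_expert_le (h : Assumptions H D T P f)
    {i e : ℕ} (he : 1 ≤ e) (heT : e ≤ T)
    (hi : i ∈ (roundState P f e).active) {c : ℝ} (hc : logTerm P f e ≤ c) :
    ∑ u ∈ Finset.Ico i (e + 1), f u (decision P f u)
        - ∑ u ∈ Finset.Ico i (e + 1), f u (point P f i u)
      ≤ c + √(2 * c * ∑ u ∈ Finset.Ico i (e + 1), f u (point P f i u)) := by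
  have hC := h.C_pos.le
  obtain ⟨h1, h2, h3, -⟩ := (mem_active_iff hC he).1 hi
  have hpot := potential_le_of_hedge (act := fun u => (roundState P f u).active)
    (I := markers P f e) (r := gap P f) (s := e)
    (R := fun t i => ∑ u ∈ Finset.Icc 1 t, if i ∈ (roundState P f u).active
      then gap P f u i else 0)
    (A := fun t i => ∑ u ∈ Finset.Icc 1 t, if i ∈ (roundState P f u).active
      then |gap P f u i| else 0)
    (i := i)
    (by
      intro t ht j hj
      have ht' := Finset.mem_Icc.1 ht
      obtain ⟨h4, h5, h6, -⟩ := (mem_active_iff hC ht'.1).1 hj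
      simp only [markers, Finset.mem_filter, Finset.mem_Icc]
      exact ⟨⟨h4, by omega⟩, h6⟩)
    (by
      intro t ht j _
      exact h.abs_gap_le (Finset.Icc_subset_Icc_right heT ht) j)
    (fun _ _ => rfl) (fun _ _ => rfl)
    (by
      intro t ht
      refine le_of_eq_of_le (Finset.sum_congr rfl fun j hj => ?_)
        (h.sum_weight_mul_gap_le (Finset.Icc_subset_Icc_right heT ht))
      have ht' := Finset.mem_Icc.1 ht
      rw [h.sum_ite_active (by omega) hj ht'.1, h.sum_ite_active (by omega) hj ht'.1,
        Nat.sub_add_cancel ht'.1]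
      rfl)
    (by simp [markers, h1, h2, h3])
  rw [h.sum_ite_active le_rfl hi he, h.sum_ite_active le_rfl hi he] at hpot
  set L := ∑ u ∈ Finset.Ico i (e + 1), f u (point P f i u) with hL
  set A := ∑ u ∈ Finset.Ico i (e + 1), |gap P f u i| with hA
  have hR : ∑ u ∈ Finset.Ico i (e + 1), gap P f u i
      = ∑ u ∈ Finset.Ico i (e + 1), f u (decision P f u) - L := by
    simp only [gap, Finset.sum_sub_distrib, hL]
  have hRA : ∑ u ∈ Finset.Ico i (e + 1), gap P f u i ≤ A :=
    Finset.sum_le_sum fun u _ => le_abs_self _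
  rw [← hR]
  set R := ∑ u ∈ Finset.Ico i (e + 1), gap P f u i
  -- Termwise, |a - b| ≤ (a - b) + 2b for a, b ≥ 0.
  have hAR : A ≤ R + 2 * L := by
    rw [hA, hL, Finset.mul_sum, ← Finset.sum_add_distrib]
    refine Finset.sum_le_sum fun u hu => ?_
    have hu' : u ∈ Finset.Icc 1 T := by
      simp only [Finset.mem_Ico, Finset.mem_Icc] at hu ⊢; omega
    have h5 := h.nonneg u hu' (point P f i u)
    have h6 := h.nonneg u hu' (decision P f u)
    rw [abs_le]
    unfold gap
    constructor <;> linarith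
  have hA0 : 0 ≤ A := Finset.sum_nonneg fun u _ => abs_nonneg _
  have hc0 : 0 ≤ c := (logTerm_nonneg e).trans hc
  rcases le_total R 0 with hR0 | hR0
  · exact hR0.trans (by positivity)
  apply le_add_sqrt_of_sq_le hc0
  have hsq : R ^ 2 ≤ A * c := by
    rcases hA0.eq_or_lt with hA0 | hA0
    · have : R = 0 := by linarith
      rw [this, ← hA0]; simp
    · have hN : (0 : ℝ) < (markers P f e).card := by
        exact_mod_cast one_le_numMarkers (P := P) (f := f) he
      have hB : 0 < (5 + 3 * Real.log (1 + e)) / 2 := by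
        have : 0 ≤ Real.log (1 + e) :=
          Real.log_nonneg (by linarith [(Nat.cast_nonneg e : (0 : ℝ) ≤ e)])
        positivity
      have h5 := Real.log_le_log (potential_pos R A) hpot
      rw [Real.log_mul hN.ne' hB.ne', potential, Real.log_exp, max_eq_right hR0,
        div_le_iff₀ (by positivity)] at h5
      have h6 : R ^ 2 ≤ A * logTerm P f e := by
        refine h5.trans_eq ?_
        unfold logTerm logLog numMarkers
        ring
      exact h6.trans (by gcongr)
  have h7 : A * c ≤ (R + 2 * L) * c := by gcongr
  linarith

theorem Assumptions.sogd_regret (h : Assumptions H D T P f)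
    {i e : ℕ} (h1 : 1 ≤ i) (heT : e ≤ T + 1) {w : E d}
    (hw : w ∈ P.W) :
    ∑ u ∈ Finset.Ico i e, f u (point P f i u) - ∑ u ∈ Finset.Ico i e, f u w
      ≤ √(4 * (H * D ^ 2) * ∑ u ∈ Finset.Ico i e, f u (point P f i u)
        + (D * √(2 * P.δ)) ^ 2) := by
  have := SOGD.regret_le (g := fun k => f (i + k)) h.H_nonneg h.D_pos h.δ_pos h.isClosed h.convex
    h.norm_sub_le (h.init_mem i) hw (e - i) (fun j hj => by
      have hm : i + j ∈ Finset.Icc 1 T := by rw [Finset.mem_Icc]; omega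
      exact ⟨h.smooth _ hm, h.nonneg _ hm, h.convexOn _ hm⟩)
  rw [← h.α_eq] at this
  simpa only [Finset.sum_Ico_eq_sum_range, point, Nat.add_sub_cancel_left] using this

theorem Assumptions.sum_nonneg (h : Assumptions H D T P f)
    {i e : ℕ} (h1 : 1 ≤ i) (heT : e ≤ T + 1) (x : ℕ → E d) :
    0 ≤ ∑ u ∈ Finset.Ico i e, f u (x u) :=
  Finset.sum_nonneg fun u hu => h.nonneg u (by
    simp only [Finset.mem_Ico, Finset.mem_Icc] at hu ⊢; omega) _

/-- The regret on an interval on which an expert is active. -/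
theorem Assumptions.regret_interval_le (h : Assumptions H D T P f)
    {i e : ℕ} (he : 1 ≤ e) (heT : e ≤ T)
    (hi : i ∈ (roundState P f e).active) {c : ℝ} (hc : logTerm P f e ≤ c) {w : E d}
    (hw : w ∈ P.W) :
    ∑ u ∈ Finset.Ico i (e + 1), f u (decision P f u) - ∑ u ∈ Finset.Ico i (e + 1), f u w
      ≤ aTilde H D P.δ c + √(bTilde H D c * ∑ u ∈ Finset.Ico i (e + 1), f u w) := by
  have h1 := ((mem_active_iff h.C_pos.le he).1 hi).1
  have hR := h.regret_expert_le he heT hi hc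
  have hS := sub_le_of_sub_le_sqrt h.h_nonneg h.q_pos.le
    (h.sum_nonneg h1 (by omega) (point P f i)) (h.sum_nonneg h1 (by omega) fun _ => w)
    (h.sogd_regret h1 (show e + 1 ≤ T + 1 by omega) hw)
  have hLi := h.sum_nonneg h1 (show e + 1 ≤ T + 1 by omega) (point P f i)
  have hLw := h.sum_nonneg h1 (show e + 1 ≤ T + 1 by omega) fun _ => w
  have hc0 : 0 ≤ c := (logTerm_nonneg e).trans hc
  have hh := h.h_nonneg
  have hq := h.q_pos.le
  have ha : aTilde H D P.δ c = 3 / 2 * c + 18 * (H * D ^ 2) + 2 * (D * √(2 * P.δ)) := by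
    unfold aTilde; ring
  have hb : bTilde H D c = 8 * c + 16 * (H * D ^ 2) := by unfold bTilde; ring
  rw [ha, hb]
  set Li := ∑ u ∈ Finset.Ico i (e + 1), f u (point P f i u)
  set Lw := ∑ u ∈ Finset.Ico i (e + 1), f u w
  set q := D * √(2 * P.δ)
  set k := H * D ^ 2
  have h4 : √(4 * k * Lw) ≤ k + Lw := by
    have := sqrt_mul_le_half_add (x := 2 * k) (y := 2 * Lw) (by positivity) (by positivity)
    rw [show 2 * k * (2 * Lw) = 4 * k * Lw by ring] at this
    linarith
  -- `hS` and `h4` give Li ≤ 2 Lw + 5k + q: the loss of the expert is replaced by that of the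
  -- comparator under the root.
  have h5 : √(2 * c * Li) ≤ √(4 * c * Lw) + (c / 2 + (5 * k + q)) := by
    have h6 : 2 * c * Li ≤ 4 * c * Lw + 2 * c * (5 * k + q) := by
      have : 2 * c * Li ≤ 2 * c * (2 * Lw + (5 * k + q)) := by gcongr; linarith
      linarith
    have h7 : √(4 * c * Lw + 2 * c * (5 * k + q)) ≤ √(4 * c * Lw) + √(c * (2 * (5 * k + q))) := by
      rw [show 2 * c * (5 * k + q) = c * (2 * (5 * k + q)) by ring]
      exact sqrt_add_le_sqrt_add_sqrt (by positivity) (by positivity)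
    have h8 := sqrt_mul_le_half_add (x := c) (y := 2 * (5 * k + q)) (by positivity) (by positivity)
    have h11 : √(2 * c * Li) ≤ √(4 * c * Lw + 2 * c * (5 * k + q)) := Real.sqrt_le_sqrt h6
    linarith
  have h9 := sqrt_add_sqrt_le (4 * c * Lw) (4 * k * Lw) (by positivity) (by positivity)
  have h10 : √(2 * (4 * c * Lw + 4 * k * Lw)) ≤ √((8 * c + 16 * k) * Lw) := by
    apply Real.sqrt_le_sqrt
    nlinarith [mul_nonneg hh hLw]
  linarith

/-- The loss of the learner in the rounds of the latest expert. -/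
theorem Assumptions.sum_decision_le (h : Assumptions H D T P f) {i e : ℕ} (he : 1 ≤ e) (heT : e ≤ T)
    (h1 : 1 ≤ i) (hie : i ≤ e) (hi : IsMarker P f i)
    (hn : numMarkers P f i = numMarkers P f e) {c : ℝ} (hc : logTerm P f e ≤ c) :
    ∑ u ∈ Finset.Ico i (e + 1), f u (decision P f u) ≤ 2 * (P.C + 1) + 3 / 2 * c := by
  have hR := h.regret_expert_le he heT ((mem_active_iff h.C_pos.le he).2
    ⟨h1, hie, hi, by rw [← hn]; exact lt_endIndex _⟩) hc
  have h2 := sum_le_of_numMarkers_eq h.C_pos.le he hi hn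
  have h3 := h.le_one e (by rw [Finset.mem_Icc]; omega) _ (h.point_mem i e)
  have h4 : ∑ u ∈ Finset.Ico i (e + 1), f u (point P f i u) ≤ P.C + 1 := by
    rw [Finset.sum_Ico_succ_top hie]
    linarith
  have hL := h.sum_nonneg h1 (show e + 1 ≤ T + 1 by omega) (point P f i)
  have hc0 : 0 ≤ c := (logTerm_nonneg e).trans hc
  have h5 := sqrt_mul_le_half_add (x := c)
    (y := 2 * ∑ u ∈ Finset.Ico i (e + 1), f u (point P f i u)) hc0 (by positivity)
  rw [show c * (2 * ∑ u ∈ Finset.Ico i (e + 1), f u (point P f i u))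
    = 2 * c * ∑ u ∈ Finset.Ico i (e + 1), f u (point P f i u) by ring] at h5
  linarith

/-- Between consecutive markers an expert exceeds the threshold, so the comparator loses at least
C/4 there; the inequality sums this over the completed stretches. -/
theorem Assumptions.numMarkers_mul_le (h : Assumptions H D T P f)
    {s : ℕ} (hs : s ≤ T) {w : E d} (hw : w ∈ P.W) (n : ℕ) :
    ∀ i, 1 ≤ i → i ≤ s → IsMarker P f i → s - i ≤ n →
      ((numMarkers P f s : ℝ) - numMarkers P f i) * (P.C / 4)
        ≤ ∑ u ∈ Finset.Ico i (s + 1), f u w := by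
  induction n with
  | zero =>
    intro i h1 h2 _ h4
    obtain rfl : i = s := by omega
    rw [sub_self, zero_mul]
    exact h.sum_nonneg h1 (by omega) fun _ => w
  | succ n ih =>
    intro i h1 h2 h3 h4
    rcases (numMarkers_mono (P := P) (f := f) h2).eq_or_lt with h5 | h5
    · rw [h5, sub_self, zero_mul]
      exact h.sum_nonneg h1 (by omega) fun _ => w
    · obtain ⟨j, hj1, hj2, hj3, hj4⟩ := exists_isMarker (P := P) (f := f)
        (Nat.le_add_left 1 (numMarkers P f i)) h5
      have hij : i < j := by
        by_contra! h
        have := numMarkers_mono (P := P) (f := f) h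
        omega
      have h6 := quarter_le_of_sub_le_sqrt h.h_nonneg h.q_pos.le h.le_C
        (lt_sum_of_isMarker h.C_pos.le h1 h3 hj3 hj4).le (h.sogd_regret h1 (by omega) hw)
      have h7 := ih j hj1 hj2 hj3 (by omega)
      rw [hj4] at h7
      push_cast at h7
      rw [← Finset.sum_Ico_consecutive _ hij.le (by omega : j ≤ s + 1)]
      linarith

/-- The regret from a marker on, bounded along a chain of covering intervals. -/
theorem Assumptions.regret_chain_le (h : Assumptions H D T P f)
    {s : ℕ} (hs : s ≤ T) {w : E d} (hw : w ∈ P.W) {c : ℝ}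
    (hc : logTerm P f s ≤ c) (n : ℕ) :
    ∀ i k, 1 ≤ i → i ≤ s → IsMarker P f i → 2 ^ k ∣ numMarkers P f i → s - i ≤ n →
      ∃ v : ℕ, 2 ^ k * 2 ^ v + numMarkers P f i ≤ numMarkers P f s + 2 ^ k ∧
        ∑ u ∈ Finset.Ico i (s + 1), f u (decision P f u) - ∑ u ∈ Finset.Ico i (s + 1), f u w
          ≤ (v + 1) * aTilde H D P.δ c
            + √((v + 1) * (bTilde H D c * ∑ u ∈ Finset.Ico i (s + 1), f u w)) := by
  have hC := h.C_pos.le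
  have hc0 : 0 ≤ c := (logTerm_nonneg s).trans hc
  have hb0 : 0 ≤ bTilde H D c := by
    have := h.H_nonneg
    unfold bTilde
    positivity
  -- A chain has v + 1 intervals. All but the last have at least 2^k, 2^(k+1), … markers, in total
  -- 2^k (2^v - 1); the first conjunct states this without subtraction. Here the expert itself lives
  -- until s, so v = 0.
  have last : ∀ i k, 1 ≤ i → i ≤ s → IsMarker P f i →
      numMarkers P f s < endIndex (numMarkers P f i) →
      ∃ v : ℕ, 2 ^ k * 2 ^ v + numMarkers P f i ≤ numMarkers P f s + 2 ^ k ∧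
        ∑ u ∈ Finset.Ico i (s + 1), f u (decision P f u) - ∑ u ∈ Finset.Ico i (s + 1), f u w
          ≤ (v + 1) * aTilde H D P.δ c
            + √((v + 1) * (bTilde H D c * ∑ u ∈ Finset.Ico i (s + 1), f u w)) := by
    intro i k h1 h2 h3 h4
    have h5 := h.regret_interval_le (by omega) hs
      ((mem_active_iff hC (by omega)).2 ⟨h1, h2, h3, h4⟩) hc hw
    refine ⟨0, ?_, by simpa using h5⟩
    have := numMarkers_mono (P := P) (f := f) h2
    rw [pow_zero, mul_one]
    omega
  induction n with
  | zero =>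
    intro i k h1 h2 h3 _ h4
    obtain rfl : i = s := by omega
    exact last i k h1 h2 h3 (lt_endIndex _)
  | succ n ih =>
    intro i k h1 h2 h3 hdvd h4
    rcases lt_or_ge (numMarkers P f s) (endIndex (numMarkers P f i)) with h5 | h5
    · exact last i k h1 h2 h3 h5
    · obtain ⟨h6, h7⟩ := endIndex_spec (one_le_numMarkers h1) hdvd
      obtain ⟨j, hj1, hj2, hj3, hj4⟩ := exists_isMarker (P := P) (f := f)
        ((one_le_numMarkers h1).trans (lt_endIndex _).le) h5
      have hlt := lt_endIndex (numMarkers P f i)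
      have hij : i < j := by
        by_contra! h
        have := numMarkers_mono (P := P) (f := f) h
        omega
      obtain ⟨v, hv, hreg⟩ := ih j (k + 1) hj1 hj2 hj3 (by rwa [hj4]) (by omega)
      -- The expert of i is still active in round j - 1, just before the marker at which it is
      -- removed.
      have hlast : numMarkers P f (j - 1) < endIndex (numMarkers P f i) := by
        rw [← hj4]
        exact numMarkers_lt hj3 (by omega)
      have h8 := h.regret_interval_le (i := i) (e := j - 1) (by omega) (by omega)
        ((mem_active_iff hC (by omega)).2 ⟨h1, by omega, h3, hlast⟩)
        ((logTerm_mono (by omega) (by omega : j - 1 ≤ s)).trans hc) hw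
      rw [Nat.sub_add_cancel hj1] at h8
      have hL1 := h.sum_nonneg h1 (show j ≤ T + 1 by omega) fun _ => w
      have hL2 := h.sum_nonneg hj1 (show s + 1 ≤ T + 1 by omega) fun _ => w
      have h9 := sqrt_add_sqrt_mul_le (n := v + 1)
        (x := bTilde H D c * ∑ u ∈ Finset.Ico i j, f u w)
        (y := bTilde H D c * ∑ u ∈ Finset.Ico j (s + 1), f u w)
        (by positivity) (by positivity) (by positivity)
      rw [← mul_add] at h9
      refine ⟨v + 1, ?_, ?_⟩
      · rw [hj4, pow_succ] at hv
        rw [pow_succ]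
        have e : 2 ^ k * 2 * 2 ^ v = 2 ^ k * (2 ^ v * 2) := by ring
        omega
      · rw [← Finset.sum_Ico_consecutive _ hij.le (by omega : j ≤ s + 1),
          ← Finset.sum_Ico_consecutive _ hij.le (by omega : j ≤ s + 1)]
        push_cast
        linarith

/-- The rounds from r to the next marker are charged to the total loss of the learner since the
latest marker, as losses are nonnegative. The chain starts at that next marker; without one up to s,
v = 0 suffices. -/
theorem Assumptions.regret_le (h : Assumptions H D T P f)
    {r s : ℕ} (hr : 1 ≤ r) (hrs : r ≤ s) (hs : s ≤ T) {w : E d}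
    (hw : w ∈ P.W) :
    ∃ v : ℕ, v ≤ ⌈Real.logb 2 (2 + 4 / P.C * cumLoss f r s w)⌉₊ ∧
      ∑ t ∈ Finset.Icc r s, (f t (decision P f t) - f t w)
        ≤ regretBound H D P.δ P.C v (logTerm P f s) (cumLoss f r s w) := by
  have hC := h.C_pos
  have inv := roundInvariant (P := P) (f := f) hC.le hr
  set i := (roundState P f r).n with hi
  simp only [cumLoss, ← Finset.Ico_add_one_right_eq_Icc, Finset.sum_sub_distrib]
  have hLr := h.sum_nonneg hr (show s + 1 ≤ T + 1 by omega) fun _ => w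
  rcases (numMarkers_mono (P := P) (f := f) hrs).eq_or_lt with heq | hlt
  · refine ⟨0, Nat.zero_le _, ?_⟩
    have h1 := h.sum_decision_le (by omega) hs inv.one_le_n (inv.n_le.trans hrs) inv.isMarker_n
      (inv.numMarkers_n.trans heq) le_rfl
    rw [← hi, ← Finset.sum_Ico_consecutive _ inv.n_le (by omega : r ≤ s + 1)] at h1
    have h2 := h.sum_nonneg inv.one_le_n (show r ≤ T + 1 by omega) (decision P f)
    simp only [regretBound, Nat.cast_zero, zero_mul, Real.sqrt_zero, add_zero]
    linarith
  · obtain ⟨j, hj1, hj2, hj3, hj4⟩ := exists_isMarker (P := P) (f := f)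
      (Nat.le_add_left 1 (numMarkers P f r)) hlt
    have hrj : r < j := by
      by_contra! h
      have := numMarkers_mono (P := P) (f := f) h
      omega
    have hnum : numMarkers P f r = numMarkers P f (j - 1) := by
      have h1 := numMarkers_mono (P := P) (f := f) (show r ≤ j - 1 by omega)
      have h2 := numMarkers_lt hj3 (show j - 1 < j by omega)
      omega
    have h1 := h.sum_decision_le (e := j - 1) (by omega) (by omega) inv.one_le_n
      (inv.n_le.trans (by omega)) inv.isMarker_n (inv.numMarkers_n.trans hnum)
      (logTerm_mono (by omega) (by omega : j - 1 ≤ s))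
    rw [Nat.sub_add_cancel hj1, ← hi, ← Finset.sum_Ico_consecutive _ inv.n_le hrj.le] at h1
    have h2 := h.sum_nonneg inv.one_le_n (show r ≤ T + 1 by omega) (decision P f)
    obtain ⟨v, hv, hreg⟩ := h.regret_chain_le hs hw le_rfl _ j 0 hj1 hj2 hj3 (by simp) le_rfl
    have hcount := h.numMarkers_mul_le hs hw _ j hj1 hj2 hj3 le_rfl
    have h3 := h.sum_nonneg hr (show j ≤ T + 1 by omega) fun _ => w
    have h3' := h.sum_nonneg hj1 (show s + 1 ≤ T + 1 by omega) fun _ => w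
    have hsplit := Finset.sum_Ico_consecutive (fun u => f u w) hrj.le (by omega : j ≤ s + 1)
    have hb0 : 0 ≤ bTilde H D (logTerm P f s) := by
      have := h.H_nonneg
      have := logTerm_nonneg (P := P) (f := f) s
      unfold bTilde
      positivity
    refine ⟨v + 1, ?_, ?_⟩
    -- The number of intervals is v + 1, so v must lie strictly below the logarithm: 2^v ≤ 1 + 4L/C
    -- < 2 + 4L/C.
    · rw [Nat.succ_le_iff, Nat.lt_ceil, Real.lt_logb_iff_rpow_lt (by norm_num) (by positivity),
        Real.rpow_natCast]
      rw [pow_zero, one_mul] at hv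
      have hv' : (2 : ℝ) ^ v + numMarkers P f j ≤ numMarkers P f s + 1 := by exact_mod_cast hv
      have h4 : (2 : ℝ) ^ v - 1 ≤ 4 / P.C * ∑ u ∈ Finset.Ico r (s + 1), f u w := by
        rw [div_mul_eq_mul_div, le_div_iff₀ hC]
        have : ((2 : ℝ) ^ v - 1) * P.C
            ≤ ((numMarkers P f s : ℝ) - numMarkers P f j) * P.C :=
          mul_le_mul_of_nonneg_right (by linarith) hC.le
        linarith
      linarith
    · have h5 : √((v + 1) * (bTilde H D (logTerm P f s) * ∑ u ∈ Finset.Ico j (s + 1), f u w))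
          ≤ √((v + 1) * bTilde H D (logTerm P f s) * ∑ u ∈ Finset.Ico r (s + 1), f u w) := by
        rw [← mul_assoc]
        exact Real.sqrt_le_sqrt (mul_le_mul_of_nonneg_left (by linarith) (by positivity))
      rw [← hsplit, ← Finset.sum_Ico_consecutive (fun u => f u (decision P f u)) hrj.le
        (by omega : j ≤ s + 1)]
      rw [← hsplit] at h5
      simp only [regretBound, Nat.cast_add, Nat.cast_one]
      linarith

theorem Assumptions.logTerm_le (h : Assumptions H D T P f)
    {t : ℕ} (ht : t ∈ Finset.Icc 1 T) {w : E d} (hw : w ∈ P.W) :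
    logTerm P f t ≤ 3 * Real.log (1 + 4 / P.C * cumLoss f 1 t w) + 3 * logLog t := by
  have hC := h.C_pos
  obtain ⟨h1, h2⟩ := Finset.mem_Icc.1 ht
  have h3 := h.numMarkers_mul_le h2 hw _ 1 le_rfl h1 isMarker_one le_rfl
  have h4 : numMarkers P f 1 = 1 := by
    rw [numMarkers_succ_of_isMarker isMarker_one]
    simp [numMarkers, markers]
  rw [h4, Nat.cast_one, Finset.Ico_add_one_right_eq_Icc] at h3
  have h5 : (numMarkers P f t : ℝ) ≤ 1 + 4 / P.C * cumLoss f 1 t w := by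
    unfold cumLoss
    rw [← sub_le_iff_le_add', div_mul_eq_mul_div, le_div_iff₀ hC]
    linarith
  have h6 : (0 : ℝ) < numMarkers P f t := by exact_mod_cast one_le_numMarkers h1
  have h7 := Real.log_le_log h6 h5
  unfold logTerm
  linarith

end Bounds

/-! ### The rate of the bound -/

theorem half_le_log {x : ℝ} (hx : 2 ≤ x) : 1 / 2 ≤ Real.log x :=
  (by linarith [Real.log_two_gt_d9] : 1 / 2 ≤ Real.log 2).trans
    (Real.log_le_log two_pos hx)

theorem half_le_logLog (t : ℕ) : 1 / 2 ≤ logLog t := by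
  have : 0 ≤ Real.log (1 + t) := Real.log_nonneg (by linarith [(Nat.cast_nonneg t : (0 : ℝ) ≤ t)])
  exact half_le_log (by linarith)

/-- The rate of the regret bound. -/
theorem regretBound_rate {H D δ C : ℝ} (hH : 0 ≤ H) (hD : 0 ≤ D) (hC : 0 < C) :
    ∃ K : ℝ, 0 < K ∧ ∀ (v : ℕ) (c L L₁ lam : ℝ), 0 ≤ c → 2 ≤ L → L ≤ L₁ → 1 / 2 ≤ lam →
      c ≤ 3 * Real.log (1 + 4 / C * L₁) + 3 * lam →
      v ≤ ⌈Real.logb 2 (2 + 4 / C * L)⌉₊ →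
      regretBound H D δ C v c L ≤ K * (√(L * (lam * Real.log L₁ * Real.log L))
          + lam * Real.log L₁ * Real.log L) ∧
        (lam * Real.log L₁ * Real.log L ≤ L →
          regretBound H D δ C v c L ≤ K * √(L * (lam * Real.log L₁ * Real.log L))) := by
  obtain ⟨κ, hκ⟩ : ∃ z : ℝ, z = Real.log (1 + 4 / C) := ⟨_, rfl⟩
  obtain ⟨κ₂, hκ₂⟩ : ∃ z : ℝ, z = Real.log (2 + 4 / C) := ⟨_, rfl⟩
  have h4C : 0 < 4 / C := by positivity
  have hκ0 : 0 ≤ κ := hκ ▸ Real.log_nonneg (by linarith)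
  have hκ₂0 : 0 ≤ κ₂ := hκ₂ ▸ Real.log_nonneg (by linarith)
  obtain ⟨A₀, hA₀⟩ : ∃ z : ℝ, z = 18 * H * D ^ 2 + 2 * D * √(2 * δ) := ⟨_, rfl⟩
  have hA₀0 : 0 ≤ A₀ := by rw [hA₀]; positivity
  obtain ⟨K₁, hK₁⟩ : ∃ z : ℝ, z = 12 * κ + 12 := ⟨_, rfl⟩
  obtain ⟨K₂, hK₂⟩ : ∃ z : ℝ, z = 4 * κ₂ + 4 := ⟨_, rfl⟩
  obtain ⟨K₃, hK₃⟩ : ∃ z : ℝ, z = 3 / 2 * K₁ + 4 * A₀ := ⟨_, rfl⟩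
  obtain ⟨K₄, hK₄⟩ : ∃ z : ℝ, z = 8 * K₁ + 64 * (H * D ^ 2) := ⟨_, rfl⟩
  have hK₁0 : 0 < K₁ := by rw [hK₁]; positivity
  have hK₂0 : 0 < K₂ := by rw [hK₂]; positivity
  have hK₃0 : 0 < K₃ := by rw [hK₃]; positivity
  have hK₄0 : 0 < K₄ := by rw [hK₄]; positivity
  refine ⟨16 * (C + 1) + 3 * K₁ + K₂ * K₃ + √(K₂ * K₄), by positivity, ?_⟩
  intro v c L L₁ lam hc0 hL hLL hlam hc hv
  obtain ⟨y, hy⟩ : ∃ z : ℝ, z = Real.log L := ⟨_, rfl⟩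
  obtain ⟨x, hx⟩ : ∃ z : ℝ, z = lam * Real.log L₁ := ⟨_, rfl⟩
  rw [← hx, ← hy]
  -- Each of `lam`, ln L₁ and ln L is at least 1/2, so every additive constant can be absorbed into
  -- a multiple of their products.
  have hy0 : 1 / 2 ≤ y := hy ▸ half_le_log hL
  have hl₁ : 1 / 2 ≤ Real.log L₁ := half_le_log (hL.trans hLL)
  have hx0 : 1 / 4 ≤ x := by rw [hx]; nlinarith only [hl₁, hlam]
  have hax : ∀ a, 0 ≤ a → a ≤ 4 * (a * x) := fun a ha => by nlinarith only [ha, hx0]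
  have hcK : c ≤ K₁ * x := by
    have h1 : Real.log (1 + 4 / C * L₁) ≤ κ + Real.log L₁ := by
      rw [hκ, ← Real.log_mul (by positivity) (by linarith)]
      have : 0 < L₁ := by linarith
      exact Real.log_le_log (by positivity) (by linarith)
    have h2 : Real.log L₁ ≤ 2 * x := by rw [hx]; nlinarith only [hl₁, hlam]
    have h3 : lam ≤ 2 * x := by rw [hx]; nlinarith only [hl₁, hlam]
    have h4 := hax κ hκ0
    rw [hK₁]
    linarith
  have hvK : (v : ℝ) ≤ K₂ * y := by
    have h1 : (v : ℝ) ≤ Real.logb 2 (2 + 4 / C * L) + 1 := by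
      have h2 : 0 ≤ Real.logb 2 (2 + 4 / C * L) :=
        Real.logb_nonneg one_lt_two (by linarith [show 0 ≤ 4 / C * L by positivity])
      exact (Nat.cast_le.2 hv).trans (Nat.ceil_lt_add_one h2).le
    have h3 : Real.log (2 + 4 / C * L) ≤ κ₂ + y := by
      rw [hκ₂, hy, ← Real.log_mul (by positivity) (by linarith)]
      exact Real.log_le_log (by positivity) (by linarith)
    have h4 : Real.logb 2 (2 + 4 / C * L) ≤ 2 * (κ₂ + y) := by
      rw [Real.logb, div_le_iff₀ (Real.log_pos one_lt_two)]
      have h5 : 1 / 2 ≤ Real.log 2 := half_le_log le_rfl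
      nlinarith only [h3, h5, hκ₂0, hy0]
    have h5 : κ₂ ≤ 2 * (κ₂ * y) := by nlinarith only [hκ₂0, hy0]
    rw [hK₂]
    linarith
  have haK : aTilde H D δ c ≤ K₃ * x := by
    have h1 : aTilde H D δ c = 3 / 2 * c + A₀ := by unfold aTilde; rw [hA₀]; ring
    have h2 := hax A₀ hA₀0
    rw [h1, hK₃]
    linarith
  have hbK : bTilde H D c ≤ K₄ * x := by
    have h1 : bTilde H D c = 8 * c + 16 * (H * D ^ 2) := by unfold bTilde; ring
    have hh : 0 ≤ H * D ^ 2 := by positivity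
    have h2 := hax _ hh
    rw [h1, hK₄]
    linarith
  have hM0 : 1 / 8 ≤ x * y := by nlinarith only [hx0, hy0]
  have hxM : x ≤ 2 * (x * y) := by nlinarith only [hx0, hy0]
  have hva : v * aTilde H D δ c ≤ K₂ * K₃ * (x * y) := by
    calc v * aTilde H D δ c ≤ v * (K₃ * x) := by gcongr
      _ ≤ K₂ * y * (K₃ * x) := by gcongr
      _ = K₂ * K₃ * (x * y) := by ring
  have hvb : √(v * bTilde H D c * L) ≤ √(K₂ * K₄) * √(L * (x * y)) := by
    rw [← Real.sqrt_mul (by positivity)]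
    apply Real.sqrt_le_sqrt
    calc v * bTilde H D c * L ≤ v * (K₄ * x) * L := by gcongr
      _ ≤ K₂ * y * (K₄ * x) * L := by gcongr
      _ = K₂ * K₄ * (L * (x * y)) := by ring
  have hfirst : 2 * (C + 1) + 3 / 2 * c ≤ (16 * (C + 1) + 3 * K₁) * (x * y) := by
    have h1 : K₁ * x ≤ K₁ * (2 * (x * y)) := by gcongr
    have h2 : (C + 1) * (1 / 8) ≤ (C + 1) * (x * y) := by gcongr
    linarith
  have hB : regretBound H D δ C v c L
      ≤ (16 * (C + 1) + 3 * K₁ + K₂ * K₃) * (x * y) + √(K₂ * K₄) * √(L * (x * y)) := by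
    unfold regretBound
    linarith
  have hM : 0 ≤ x * y := by linarith
  have hS := Real.sqrt_nonneg (L * (x * y))
  have hQ := Real.sqrt_nonneg (K₂ * K₄)
  have hK₀ : 0 ≤ 16 * (C + 1) + 3 * K₁ + K₂ * K₃ := by positivity
  refine ⟨hB.trans ?_, fun hML => hB.trans ?_⟩
  · linarith only [mul_nonneg hK₀ hS, mul_nonneg hQ hM]
  -- M ≤ L gives M² ≤ LM.
  · have h1 : x * y ≤ √(L * (x * y)) := Real.le_sqrt_of_sq_le (by nlinarith only [hML, hM])
    have h2 := mul_le_mul_of_nonneg_left h1 hK₀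
    linarith

end SACS

theorem theorem4 (H D δ C : ℝ) (hH : 0 ≤ H) (hD : 0 < D) (hδ : 0 < δ)
    (hC : 20 * H * D ^ 2 + 2 * D * √(2 * δ) ≤ C) :
    -- the constant of the rate depends on `H`, `D`, `δ` and `C` only
    ∃ K : ℝ, 0 < K ∧
    ∀ (d T : ℕ) (W : Set (SACS.E d)) (f : ℕ → SACS.E d → ℝ) (init fallback : ℕ → SACS.E d),
      IsClosed W → Convex ℝ W → (∀ x ∈ W, ∀ y ∈ W, ‖x - y‖ ≤ D) →
      (∀ t, init t ∈ W) → (∀ t, fallback t ∈ W) →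
      (∀ t ∈ Finset.Icc 1 T, ConvexOn ℝ W (f t) ∧ ∀ x, 0 ≤ f t x) →
      (∀ t ∈ Finset.Icc 1 T, SACS.SmoothAround H W (f t)) →
      (∀ t ∈ Finset.Icc 1 T, ∀ x ∈ W, f t x ≤ 1) →
      ∃ c : ℕ → ℝ,
        (∀ t ∈ Finset.Icc 1 T, 0 ≤ c t ∧ ∀ w ∈ W,
          c t ≤ 3 * Real.log (1 + 4 / C * SACS.cumLoss f 1 t w) + 3 * SACS.logLog t) ∧
        ∀ r s : ℕ, 1 ≤ r → r ≤ s → s ≤ T → ∀ w ∈ W,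
          ∃ v : ℕ, v ≤ ⌈Real.logb 2 (2 + 4 / C * SACS.cumLoss f r s w)⌉₊ ∧
            -- the regret bound
            ∑ t ∈ Finset.Icc r s,
                (f t (SACS.decision ⟨W, D / √2, δ, C, init, fallback⟩ f t) - f t w)
              ≤ SACS.regretBound H D δ C v (c s) (SACS.cumLoss f r s w) ∧
            -- its rate, with the lower-order term
            (2 ≤ SACS.cumLoss f r s w →
              SACS.regretBound H D δ C v (c s) (SACS.cumLoss f r s w)
                ≤ K * (√(SACS.cumLoss f r s w * (SACS.logLog s *
                      Real.log (SACS.cumLoss f 1 s w) * Real.log (SACS.cumLoss f r s w)))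
                    + SACS.logLog s *
                      Real.log (SACS.cumLoss f 1 s w) * Real.log (SACS.cumLoss f r s w))) ∧
            -- its rate, in the regime in which the square root dominates
            (2 ≤ SACS.cumLoss f r s w →
              SACS.logLog s * Real.log (SACS.cumLoss f 1 s w) * Real.log (SACS.cumLoss f r s w)
                ≤ SACS.cumLoss f r s w →
              SACS.regretBound H D δ C v (c s) (SACS.cumLoss f r s w)
                ≤ K * √(SACS.cumLoss f r s w * (SACS.logLog s *
                      Real.log (SACS.cumLoss f 1 s w) * Real.log (SACS.cumLoss f r s w)))) := by
  have hq : 0 < D * √(2 * δ) := mul_pos hD (Real.sqrt_pos.2 (by linarith))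
  have hh : 0 ≤ H * D ^ 2 := by positivity
  have hC0 : 0 < C := by linarith
  obtain ⟨K, hK, hrate⟩ := SACS.regretBound_rate (H := H) (D := D) (δ := δ) hH hD.le hC0
  refine ⟨K, hK, ?_⟩
  intro d T W f init fallback hcl hconv hdiam hinit hfall hf hsm hone
  have h : SACS.Assumptions H D T ⟨W, D / √2, δ, C, init, fallback⟩ f :=
    { H_nonneg := hH
      D_pos := hD
      δ_pos := hδ
      α_eq := rfl
      le_C := by linarith
      isClosed := hcl
      convex := hconv
      norm_sub_le := hdiam
      init_mem := hinit
      fallback_mem := hfall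
      convexOn := fun t ht => (hf t ht).1
      nonneg := fun t ht => (hf t ht).2
      smooth := hsm
      le_one := hone }
  -- The witness depends on the number of markers only; the comparator enters through the bound on
  -- that number.
  refine ⟨SACS.logTerm ⟨W, D / √2, δ, C, init, fallback⟩ f,
    fun t ht => ⟨SACS.logTerm_nonneg t, fun w hw => h.logTerm_le ht hw⟩, ?_⟩
  intro r s hr hrs hs w hw
  obtain ⟨v, hv, hreg⟩ := h.regret_le hr hrs hs hw
  have hLL : SACS.cumLoss f r s w ≤ SACS.cumLoss f 1 s w :=
    Finset.sum_le_sum_of_subset_of_nonneg (Finset.Icc_subset_Icc_left hr)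
      fun t ht _ => (hf t (Finset.Icc_subset_Icc_right hs ht)).2 w
  have hB := fun hL => hrate v _ _ _ _ (SACS.logTerm_nonneg s) hL hLL
    (SACS.half_le_logLog s)
    (h.logTerm_le (Finset.mem_Icc.2 ⟨hr.trans hrs, hs⟩) hw) hv
  refine ⟨v, hv, hreg, fun hL => (hB hL).1, fun hL hM => (hB hL).2 hM⟩
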